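/- Let $\Theta=\{\theta_0,\dots,\theta_n\}$ be a finite set of states, and let $\widehat\Delta_n=\{q\in[0,1]^n:\sum_{i=1}^n q_i\le 1\}$ be the set of beliefs ($q_i$ is the probability of $\theta_i$ for $i\ge 1$, and $q_0:=1-\sum_{i=1}^n q_i$ is that of $\theta_0$). An experiment $F$ generates a signal $x$ in a compact interval $\mathcal X\subset\mathbb R$, distributed in state $\theta_i$ according to a density $f(\cdot\mid\theta_i)$. For a prior $q$ let $f_q=\sum_{i=0}^n q_if(\cdot\mid\theta_i)$ be the unconditional density of the signal, and $p_F(x;q)=\big(q_if(x\mid\theta_i)/f_q(x)\big)_{i=1}^n$ the posterior. Write $F\succeq_{LB}G$ (linear-Blackwell order) if for every $q\in\widehat\Delta_n$, every $b\in\mathbb R^n$ and every convex $C:\mathbb R\to\mathbb R$, $$\mathbb E\big[C\big(b\cdot p_F(X;q)\big)\big]\ \ge\ \mathbb E\big[C\big(b\cdot p_G(Y;q)\big)\big],$$ where the signals $X$ of $F$ and $Y$ of $G$ follow their unconditional distributions under $q$. A screening environment $\mathcal E$ consists of a finite nonempty set $\mathcal A$ of alternatives; a common prior $q\in\widehat\Delta_n$;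 a finite set $\mathcal P\subset\widehat\Delta_n$ of types and a probability distribution $\pi$ on $\mathcal P$ with mean $q$; a function $\psi:\mathcal A\to[0,1]$; functions $v_1,u_1:\mathcal A\times\Theta\to\mathbb R$; a continuous convex function $v_2:\mathbb R\to\mathbb R$; and bounds $\underline m<\overline m$ in $\mathbb R$. The agent privately learns his type $p\in\mathcal P$, drawn from $\pi$, which is his belief about the state. After alternative $a$ has been chosen, an ex post signal is observed: with probability $\psi(a)$ it is the signal of the experiment $F$, otherwise it is an uninformative signal $\perp$; let $F^a(\cdot\mid\theta_i)$ be its distribution on $\mathcal X\cup\{\perp\}$ in state $\theta_i$. If $a$ is chosen and the transfer is $t$, then in state $\theta$ the principal gets $v_1(a,\theta)-v_2(t)$ and the agent gets $u_1(a,\theta)+t$. A mechanism consists of an allocation rule $\hat a$, which assigns to each $p\in\mathcal P$ a probability distribution $\hat a(\cdot\mid p)$ on $\mathcal A$, and a Borel transfer rule $\hat t:\mathcal P\times\mathcal A\times(\mathcal X\cup\{\perp\})\to[\underline m,\overline m]$. The expected utility of a type $p$ who reports $p'$ is $$U(p,p')=\sum_{a\in\mathcal A}\hat a(a\mid p')\sum_{i=0}^n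 p_i\Big(u_1(a,\theta_i)+\int \hat t(p',a,x)\,dF^a(x\mid\theta_i)\Big).$$ Let $W_F(\mathcal E)\in[-\infty,\infty)$ be the supremum of the principal's expected utility $$\sum_{p\in\mathcal P}\pi(p)\sum_{a\in\mathcal A}\hat a(a\mid p)\sum_{i=0}^n p_i\Big(v_1(a,\theta_i)-\int v_2\big(\hat t(p,a,x)\big)\,dF^a(x\mid\theta_i)\Big)$$ over all mechanisms that satisfy $U(p,p)\ge 0$ and $U(p,p)\ge U(p,p')$ for all $p,p'\in\mathcal P$ (with $W_F(\mathcal E)=-\infty$ if there are none). **Theorem 3.** For any two experiments $F$ and $G$ on $\Theta$, $F\succeq_{LB}G$ holds if and only if $W_F(\mathcal E)\ge W_G(\mathcal E)$ for every screening environment $\mathcal E$. -/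

import Mathlib

open MeasureTheory

noncomputable section

namespace LinearBlackwell

/-- Beliefs over the states `θ₀, …, θₙ`, coded by the probabilities of `θ₁, …, θₙ`. -/
def beliefs (n : ℕ) : Set (Fin n → ℝ) :=
  {q | (∀ i, q i ∈ Set.Icc (0 : ℝ) 1) ∧ ∑ i, q i ≤ 1}

/-- The probability of each of the `n + 1` states under the belief `q`; that of `θ₀` is
`1 - ∑ i, q i`. -/
def stateProb {n : ℕ} (q : Fin n → ℝ) : Fin (n + 1) → ℝ :=
  Fin.cons (1 - ∑ i, q i) q

/-- Lebesgue measure on the interval `[lo, hi]`. -/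
def intervalVolume (lo hi : ℝ) : Measure (Set.Icc lo hi) :=
  volume.comap Subtype.val

/-- A statistical experiment with `n + 1` states: a real random signal with values in the interval
`[lo, hi]`, whose conditional distribution in each state has a density with respect to Lebesgue
measure. -/
structure Experiment (n : ℕ) where
  lo : ℝ
  hi : ℝ
  lo_lt_hi : lo < hi
  density : Fin (n + 1) → Set.Icc lo hi → ℝ
  measurable_density : ∀ i, Measurable (density i)
  density_nonneg : ∀ i x, 0 ≤ density i x
  lintegral_density : ∀ i, ∫⁻ x, ENNReal.ofReal (density i x) ∂(intervalVolume lo hi) = 1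

namespace Experiment

variable {n : ℕ} (F : Experiment n)

/-- The signal space. -/
abbrev Signal : Type := Set.Icc F.lo F.hi

/-- The conditional distribution of the signal in state `i`. -/
def law (i : Fin (n + 1)) : Measure F.Signal :=
  (intervalVolume F.lo F.hi).withDensity fun x => ENNReal.ofReal (F.density i x)

/-- The unconditional density of the signal under the prior `q`. -/
def mixDensity (q : Fin n → ℝ) (x : F.Signal) : ℝ :=
  ∑ i, stateProb q i * F.density i x

/-- The unconditional distribution of the signal under the prior `q`. -/
def mixLaw (q : Fin n → ℝ) : Measure F.Signal :=
  (intervalVolume F.lo F.hi).withDensity fun x => ENNReal.ofReal (F.mixDensity q x)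

/-- The posterior belief after signal `x` under the prior `q` (the probabilities of the states
`θ₁, …, θₙ`). The value where `mixDensity` vanishes is irrelevant: this set is `mixLaw`-null. -/
def posterior (q : Fin n → ℝ) (x : F.Signal) : Fin n → ℝ :=
  fun i => q i * F.density i.succ x / F.mixDensity q x

end Experiment

/-- Convex order: the real random variable `X` (under `P`) dominates `Y` (under `Q`). It is used
below for bounded random variables only, for which all these expectations exist; the functions
`C = ± id` show that it entails equality of the means. -/
def ConvexOrder {Ω Ω' : Type*} [MeasurableSpace Ω] [MeasurableSpace Ω']
    (P : Measure Ω) (X : Ω → ℝ) (Q : Measure Ω') (Y : Ω' → ℝ) : Prop :=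
  ∀ C : ℝ → ℝ, ConvexOn ℝ Set.univ C → ∫ ω, C (Y ω) ∂Q ≤ ∫ ω, C (X ω) ∂P

/-- Linear convex order of random vectors: convex order of all linear combinations. -/
def LinearConvexOrder {Ω Ω' : Type*} [MeasurableSpace Ω] [MeasurableSpace Ω'] {n : ℕ}
    (P : Measure Ω) (X : Ω → Fin n → ℝ) (Q : Measure Ω') (Y : Ω' → Fin n → ℝ) : Prop :=
  ∀ b : Fin n → ℝ,
    ConvexOrder P (fun ω => ∑ i, b i * X ω i) Q (fun ω => ∑ i, b i * Y ω i)

/-- The linear-Blackwell order: for every prior, the posterior under `F` dominates the posterior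
under `G` in the linear convex order. -/
def Experiment.LBDominates {n : ℕ} (F G : Experiment n) : Prop :=
  ∀ q ∈ beliefs n,
    LinearConvexOrder (F.mixLaw q) (F.posterior q) (G.mixLaw q) (G.posterior q)

/-- A screening environment with `n + 1` states. The alternatives are `a₀, …, aₖ`. -/
structure ScreeningEnvironment (n : ℕ) where
  /-- the number of alternatives is `k + 1` -/
  k : ℕ
  /-- the common prior -/
  prior : Fin n → ℝ
  prior_mem : prior ∈ beliefs n
  /-- the finite set of types; a type is the agent's private belief -/
  types : Finset (Fin n → ℝ)
  types_subset : ∀ p ∈ types, p ∈ beliefs n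
  /-- the distribution of the type -/
  typeProb : types → ℝ
  typeProb_mem : typeProb ∈ stdSimplex ℝ types
  mean_type : ∑ p, typeProb p • (p : Fin n → ℝ) = prior
  /-- the probability that the informative ex post signal is generated -/
  psi : Fin (k + 1) → ℝ
  psi_mem : ∀ a, psi a ∈ Set.Icc (0 : ℝ) 1
  /-- the principal's utility from the alternative in each state -/
  v₁ : Fin (k + 1) → Fin (n + 1) → ℝ
  /-- the principal's disutility from the transfer -/
  v₂ : ℝ → ℝ
  continuous_v₂ : Continuous v₂
  convexOn_v₂ : ConvexOn ℝ Set.univ v₂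
  /-- the agent's utility from the alternative in each state -/
  u₁ : Fin (k + 1) → Fin (n + 1) → ℝ
  /-- the lower bound on transfers -/
  mLo : ℝ
  /-- the upper bound on transfers -/
  mHi : ℝ
  mLo_lt_mHi : mLo < mHi

namespace ScreeningEnvironment

variable {n : ℕ} (E : ScreeningEnvironment n) (F : Experiment n)

/-- The conditional distribution of the ex post signal, given the alternative `a` and the state `i`:
with probability `psi a` the signal of `F`, otherwise the uninformative signal `⊥`, which is
`Sum.inr ()`. -/
def exPostLaw (a : Fin (E.k + 1)) (i : Fin (n + 1)) : Measure (F.Signal ⊕ Unit) :=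
  ENNReal.ofReal (E.psi a) • (F.law i).map Sum.inl
    + ENNReal.ofReal (1 - E.psi a) • Measure.dirac (Sum.inr ())

/-- A direct mechanism: an allocation rule with values in the lotteries over alternatives, and a
Borel transfer rule that respects the bounds on transfers. -/
structure Mechanism where
  alloc : E.types → Fin (E.k + 1) → ℝ
  alloc_mem : ∀ p, alloc p ∈ stdSimplex ℝ (Fin (E.k + 1))
  transfer : E.types → Fin (E.k + 1) → F.Signal ⊕ Unit → ℝ
  measurable_transfer : ∀ p a, Measurable (transfer p a)
  transfer_mem : ∀ p a s, transfer p a s ∈ Set.Icc E.mLo E.mHi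

variable {E F}

/-- The expected utility of an agent of type `p` who reports type `p'`. -/
def Mechanism.agentUtility (M : E.Mechanism F) (p p' : E.types) : ℝ :=
  ∑ a, M.alloc p' a * ∑ i, stateProb (p : Fin n → ℝ) i *
    (E.u₁ a i + ∫ s, M.transfer p' a s ∂(E.exPostLaw F a i))

/-- Individual rationality and incentive compatibility. -/
def Mechanism.Feasible (M : E.Mechanism F) : Prop :=
  (∀ p, 0 ≤ M.agentUtility p p) ∧ ∀ p p', M.agentUtility p p' ≤ M.agentUtility p p

/-- The principal's expected utility when the agent reports truthfully. -/
def Mechanism.principalUtility (M : E.Mechanism F) : ℝ :=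
  ∑ p, E.typeProb p * ∑ a, M.alloc p a * ∑ i, stateProb (p : Fin n → ℝ) i *
    (E.v₁ a i - ∫ s, E.v₂ (M.transfer p a s) ∂(E.exPostLaw F a i))

variable (E F)

/-- The principal's optimal expected utility: the supremum over all feasible mechanisms, which is
`-∞` if there is none. -/
def optimalValue : EReal :=
  ⨆ (M : E.Mechanism F) (_ : M.Feasible), (M.principalUtility : EReal)

end ScreeningEnvironment

end LinearBlackwell

end

/-! Both directions rest on one reformulation. For strictly positive weights `w` summing to one, `∑
lᵢ fᵢ` divided by `∑ wᵢ fᵢ` is an affine function of the posterior under the prior `w`. Hence linear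
combinations of posteriors, convex functions of them, and linear functionals of the conditional
signal laws carry the same information.

From the order to the values, it suffices that any transfer rule based on `G` can be matched by one
based on `F` with the same mean in every state and no higher expected cost
(`Experiment.LBDominates.exists_transfer`): the agent's payoffs from all reports are then unchanged.
The pairs (state-wise means, upper bound of the cost) attainable with `F` form a convex set, closed
by weak compactness of bounded sets in `L²` (`isClosed_outcomes`). A pair outside it would be
strictly separated from it by a functional. Evaluated along transfer rules, that functional is a
Lagrangian whose pointwise minimum over the transfer is a concave function of a linear combination
of posteriors. Dominance makes its expectation under `F` at most that under `G`, a contradiction.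

From the values to the order, convex functions on a compact interval are limits of affine functions
plus hinges, so only `∫ max 0 (∑ lᵢ gᵢ) ≤ ∫ max 0 (∑ lᵢ fᵢ)` is needed (`lbDominates_of_hinges`).
This integral is the largest value of `∑ lᵢ E[t | θᵢ]` over tests `t` with values in `[0, 1]`.
Splitting `l` into positive and negative parts gives two types with disjoint supports. In a two-type
environment the principal has to compensate the first type while leaving little rent to the second,
so comparing optimal values compares the tests available under `F` and `G`
(`hinge_le_of_optimalValue_le`). -/

noncomputable section

namespace LinearBlackwell

/-! ### Beliefs as probability vectors on all states -/

section Beliefs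

variable {n : ℕ}

lemma stateProb_zero (q : Fin n → ℝ) : stateProb q 0 = 1 - ∑ i, q i := rfl

lemma stateProb_succ (q : Fin n → ℝ) (i : Fin n) : stateProb q i.succ = q i := rfl

lemma sum_stateProb (q : Fin n → ℝ) : ∑ i, stateProb q i = 1 := by
  simp [Fin.sum_univ_succ, stateProb_zero, stateProb_succ]

lemma stateProb_nonneg {q : Fin n → ℝ} (hq : q ∈ beliefs n) (i : Fin (n + 1)) :
    0 ≤ stateProb q i := by
  refine Fin.cases ?_ (fun j => ?_) i
  · have := hq.2
    rw [stateProb_zero]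
    linarith
  · exact (hq.1 j).1

lemma stateProb_comp_succ {w : Fin (n + 1) → ℝ} (hw : ∑ i, w i = 1) :
    stateProb (fun i => w i.succ) = w := by
  funext i
  refine Fin.cases ?_ (fun j => ?_) i
  · rw [Fin.sum_univ_succ] at hw
    rw [stateProb_zero]
    linarith
  · rfl

lemma comp_succ_mem_beliefs {w : Fin (n + 1) → ℝ} (hw0 : ∀ i, 0 ≤ w i) (hw : ∑ i, w i = 1) :
    (fun i : Fin n => w i.succ) ∈ beliefs n := by
  have h := hw
  rw [Fin.sum_univ_succ] at h
  have h0 := hw0 0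
  refine ⟨fun i => ⟨hw0 _, ?_⟩, by linarith⟩
  rw [← hw]
  exact Finset.single_le_sum (f := w) (fun j _ => hw0 j) (Finset.mem_univ i.succ)

lemma convex_beliefs (n : ℕ) : Convex ℝ (beliefs n) := by
  intro p hp q hq a b ha hb hab
  refine ⟨fun i => ?_, ?_⟩
  · exact convex_Icc (0 : ℝ) 1 (hp.1 i) (hq.1 i) ha hb hab
  · have : ∑ i, (a • p + b • q) i = a * ∑ i, p i + b * ∑ i, q i := by
      simp [Finset.sum_add_distrib, Finset.mul_sum]
    rw [this]
    nlinarith [hp.2, hq.2, mul_le_mul_of_nonneg_left hp.2 ha, mul_le_mul_of_nonneg_left hq.2 hb]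

end Beliefs

/-! ### Integration against signal laws; posteriors -/

namespace Experiment

variable {n : ℕ} (F : Experiment n)

lemma integrable_density (i : Fin (n + 1)) :
    Integrable (F.density i) (intervalVolume F.lo F.hi) := by
  refine ⟨(F.measurable_density i).aestronglyMeasurable, ?_⟩
  rw [hasFiniteIntegral_iff_ofReal (ae_of_all _ (F.density_nonneg i)), F.lintegral_density i]
  exact ENNReal.one_lt_top

lemma integral_density (i : Fin (n + 1)) :
    ∫ x, F.density i x ∂(intervalVolume F.lo F.hi) = 1 := by
  rw [integral_eq_lintegral_of_nonneg_ae (ae_of_all _ (F.density_nonneg i))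
    (F.measurable_density i).aestronglyMeasurable, F.lintegral_density i]
  simp

instance isProbabilityMeasure_law (i : Fin (n + 1)) : IsProbabilityMeasure (F.law i) :=
  ⟨by rw [law, withDensity_apply _ MeasurableSet.univ, Measure.restrict_univ,
    F.lintegral_density i]⟩

lemma integral_withDensity_ofReal {X : Type*} [MeasurableSpace X] {μ : Measure X} {f : X → ℝ}
    (hf : Measurable f) (hf0 : ∀ x, 0 ≤ f x) (g : X → ℝ) :
    ∫ x, g x ∂(μ.withDensity fun x => ENNReal.ofReal (f x)) = ∫ x, f x * g x ∂μ := by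
  rw [integral_withDensity_eq_integral_toReal_smul hf.ennreal_ofReal
    (ae_of_all _ fun _ => ENNReal.ofReal_lt_top)]
  simp [ENNReal.toReal_ofReal (hf0 _)]

lemma integral_law (i : Fin (n + 1)) (g : F.Signal → ℝ) :
    ∫ x, g x ∂(F.law i) = ∫ x, F.density i x * g x ∂(intervalVolume F.lo F.hi) :=
  integral_withDensity_ofReal (F.measurable_density i) (F.density_nonneg i) g

lemma integrable_density_mul (i : Fin (n + 1)) {g : F.Signal → ℝ} (hg : Measurable g) {B : ℝ}
    (hB : ∀ x, |g x| ≤ B) :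
    Integrable (fun x => F.density i x * g x) (intervalVolume F.lo F.hi) :=
  (F.integrable_density i).mul_bdd (c := B) hg.aestronglyMeasurable (ae_of_all _ hB)

lemma sum_mul_integral_law (c : Fin (n + 1) → ℝ) {g : F.Signal → ℝ} (hg : Measurable g) {B : ℝ}
    (hB : ∀ x, |g x| ≤ B) :
    ∑ i, c i * ∫ x, g x ∂(F.law i)
      = ∫ x, (∑ i, c i * F.density i x) * g x ∂(intervalVolume F.lo F.hi) := by
  simp_rw [integral_law, ← integral_const_mul, Finset.sum_mul, mul_assoc]
  rw [integral_finsetSum]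
  exact fun i _ => (F.integrable_density_mul i hg hB).const_mul _

lemma measurable_mixDensity (q : Fin n → ℝ) : Measurable (F.mixDensity q) :=
  Finset.measurable_sum _ fun i _ => (F.measurable_density i).const_mul _

lemma integrable_mixDensity (q : Fin n → ℝ) :
    Integrable (F.mixDensity q) (intervalVolume F.lo F.hi) :=
  integrable_finsetSum _ fun i _ => (F.integrable_density i).const_mul _

lemma integral_mixDensity (q : Fin n → ℝ) :
    ∫ x, F.mixDensity q x ∂(intervalVolume F.lo F.hi) = 1 := by
  unfold mixDensity
  rw [integral_finsetSum _ fun i _ => (F.integrable_density i).const_mul _]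
  simp_rw [integral_const_mul, integral_density, mul_one, sum_stateProb]

lemma mixDensity_nonneg {q : Fin n → ℝ} (hq : q ∈ beliefs n) (x : F.Signal) :
    0 ≤ F.mixDensity q x :=
  Finset.sum_nonneg fun i _ => mul_nonneg (stateProb_nonneg hq i) (F.density_nonneg i x)

lemma integral_mixLaw {q : Fin n → ℝ} (hq : q ∈ beliefs n) (g : F.Signal → ℝ) :
    ∫ x, g x ∂(F.mixLaw q) = ∫ x, F.mixDensity q x * g x ∂(intervalVolume F.lo F.hi) :=
  integral_withDensity_ofReal (F.measurable_mixDensity q) (F.mixDensity_nonneg hq) g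

lemma isProbabilityMeasure_mixLaw {q : Fin n → ℝ} (hq : q ∈ beliefs n) :
    IsProbabilityMeasure (F.mixLaw q) := by
  refine ⟨?_⟩
  rw [mixLaw, withDensity_apply _ MeasurableSet.univ, Measure.restrict_univ,
    ← ofReal_integral_eq_lintegral_ofReal (F.integrable_mixDensity q)
      (ae_of_all _ (F.mixDensity_nonneg hq)), integral_mixDensity, ENNReal.ofReal_one]

lemma stateProb_mul_density_le_mixDensity {q : Fin n → ℝ} (hq : q ∈ beliefs n) (x : F.Signal)
    (i : Fin (n + 1)) : stateProb q i * F.density i x ≤ F.mixDensity q x :=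
  Finset.single_le_sum (f := fun i => stateProb q i * F.density i x)
    (fun j _ => mul_nonneg (stateProb_nonneg hq j) (F.density_nonneg j x)) (Finset.mem_univ i)

/-- Holds at every signal: where the mixture density vanishes, each nonnegative summand vanishes
too, so the default value of division by zero is harmless. -/
lemma mixDensity_mul_posterior {q : Fin n → ℝ} (hq : q ∈ beliefs n) (x : F.Signal) (i : Fin n) :
    F.mixDensity q x * F.posterior q x i = q i * F.density i.succ x := by
  have h := F.stateProb_mul_density_le_mixDensity hq x i.succ
  rw [stateProb_succ] at h
  have h0 : 0 ≤ q i * F.density i.succ x := mul_nonneg (hq.1 i).1 (F.density_nonneg _ _)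
  rcases eq_or_ne (F.mixDensity q x) 0 with h' | h'
  · rw [h'] at h ⊢
    rw [zero_mul]
    exact le_antisymm h0 h
  · exact mul_div_cancel₀ _ h'

lemma posterior_mem_Icc {q : Fin n → ℝ} (hq : q ∈ beliefs n) (x : F.Signal) (i : Fin n) :
    F.posterior q x i ∈ Set.Icc (0 : ℝ) 1 := by
  have h := F.stateProb_mul_density_le_mixDensity hq x i.succ
  rw [stateProb_succ] at h
  have h0 : 0 ≤ q i * F.density i.succ x := mul_nonneg (hq.1 i).1 (F.density_nonneg _ _)
  exact ⟨div_nonneg h0 (F.mixDensity_nonneg hq x), div_le_one_of_le₀ h (F.mixDensity_nonneg hq x)⟩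

lemma measurable_sum_mul_posterior (q b : Fin n → ℝ) :
    Measurable fun x => ∑ i, b i * F.posterior q x i :=
  Finset.measurable_sum _ fun i _ => (((F.measurable_density i.succ).const_mul _).div
    (F.measurable_mixDensity q)).const_mul _

lemma abs_sum_mul_posterior_le {q : Fin n → ℝ} (hq : q ∈ beliefs n) (b : Fin n → ℝ)
    (x : F.Signal) : |∑ i, b i * F.posterior q x i| ≤ ∑ i, |b i| := by
  refine (Finset.abs_sum_le_sum_abs _ _).trans (Finset.sum_le_sum fun i _ => ?_)
  rw [abs_mul, abs_of_nonneg (F.posterior_mem_Icc hq x i).1]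
  exact mul_le_of_le_one_right (abs_nonneg _) (F.posterior_mem_Icc hq x i).2

end Experiment

/-! ### Weak compactness in a Hilbert space, via elements of minimal norm -/

section NestedSets

open Filter Topology

/-- A decreasing sequence of nonempty closed convex sets in a Hilbert space, the first of which is
bounded, has a common point. -/
lemma exists_mem_of_antitone_closed_convex {H : Type*} [NormedAddCommGroup H]
    [InnerProductSpace ℝ H] [CompleteSpace H] {S : ℕ → Set H} (hS : Antitone S)
    (hne : ∀ k, (S k).Nonempty) (hcl : ∀ k, IsClosed (S k)) (hco : ∀ k, Convex ℝ (S k)) {R : ℝ}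
    (hR : ∀ u ∈ S 0, ‖u‖ ≤ R) : ∃ u, ∀ k, u ∈ S k := by
  have hmin : ∀ k, ∃ v ∈ S k, ∀ w ∈ S k, ‖v‖ ≤ ‖w‖ := by
    intro k
    obtain ⟨v, hv, hv'⟩ :=
      exists_norm_eq_iInf_of_complete_convex (hne k) (hcl k).isComplete (hco k) 0
    refine ⟨v, hv, fun w hw => ?_⟩
    simp only [zero_sub, norm_neg] at hv'
    rw [hv']
    exact ciInf_le (f := fun w : S k => ‖(w : H)‖)
      ⟨0, by rintro _ ⟨w, rfl⟩; exact norm_nonneg _⟩ ⟨w, hw⟩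
  choose v hv hmin using hmin
  have hmono : Monotone fun k => ‖v k‖ ^ 2 := fun k l hkl =>
    pow_le_pow_left₀ (norm_nonneg _) (hmin k _ (hS hkl (hv l))) 2
  have hbdd : BddAbove (Set.range fun k => ‖v k‖ ^ 2) :=
    ⟨R ^ 2, by
      rintro _ ⟨k, rfl⟩
      exact pow_le_pow_left₀ (norm_nonneg _) (hR _ (hS (Nat.zero_le k) (hv k))) 2⟩
  have hlim := tendsto_atTop_ciSup hmono hbdd
  set d := ⨆ k, ‖v k‖ ^ 2
  have hle : ∀ k, ‖v k‖ ^ 2 ≤ d := fun k => le_ciSup hbdd k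
  -- The midpoint of `v k` and `v l` lies in `S k`, so its norm is at least `‖v k‖`. The
  -- parallelogram law then bounds the distance by the gap of the squared norms, which increase to
  -- `d`; so the minimal elements form a Cauchy sequence.
  have key : ∀ k l, k ≤ l → ‖v k - v l‖ ^ 2 ≤ 2 * (d - ‖v k‖ ^ 2) := by
    intro k l hkl
    have h1 := parallelogram_law_with_norm ℝ (v k) (v l)
    have hmem : (2⁻¹ : ℝ) • v k + (2⁻¹ : ℝ) • v l ∈ S k :=
      hco k (hv k) (hS hkl (hv l)) (by norm_num) (by norm_num) (by norm_num)
    have h2 := hmin k _ hmem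
    rw [← smul_add, norm_smul, Real.norm_of_nonneg (by norm_num)] at h2
    have h3 : (2 * ‖v k‖) ^ 2 ≤ ‖v k + v l‖ ^ 2 :=
      pow_le_pow_left₀ (by positivity) (by linarith) 2
    have h4 := hle l
    nlinarith
  have hgap : Tendsto (fun k => 2 * (d - ‖v k‖ ^ 2)) atTop (𝓝 0) := by
    simpa using ((tendsto_const_nhds (x := d)).sub hlim).const_mul (2 : ℝ)
  have hcauchy : CauchySeq v := by
    rw [Metric.cauchySeq_iff']
    intro ε hε
    obtain ⟨N, hN⟩ := (hgap.eventually (gt_mem_nhds (show (0 : ℝ) < ε ^ 2 by positivity))).exists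
    refine ⟨N, fun l hl => ?_⟩
    rw [dist_comm, dist_eq_norm]
    exact lt_of_pow_lt_pow_left₀ 2 hε.le ((key N l hl).trans_lt hN)
  obtain ⟨u, hu⟩ := cauchySeq_tendsto_of_complete hcauchy
  exact ⟨u, fun k => (hcl k).mem_of_tendsto hu
    (eventually_atTop.2 ⟨k, fun l hl => hS hl (hv l)⟩)⟩

end NestedSets

/-! ### The set of attainable means and costs is convex and closed -/

section Outcomes

open Filter Topology

variable {Ω : Type*} [MeasurableSpace Ω] {ι : Type*} [Fintype ι] {lo hi : ℝ} {v : ℝ → ℝ}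

lemma integrable_comp_of_mem_Icc {μ : Measure Ω} [IsFiniteMeasure μ] (hv : Continuous v)
    {u : Ω → ℝ} (hu : AEStronglyMeasurable u μ) (hmem : ∀ᵐ x ∂μ, u x ∈ Set.Icc lo hi) :
    Integrable (fun x => v (u x)) μ := by
  obtain ⟨B, hB⟩ := (isCompact_Icc (a := lo) (b := hi)).exists_bound_of_continuousOn hv.continuousOn
  exact Integrable.of_bound (hv.comp_aestronglyMeasurable hu) B
    (hmem.mono fun x hx => hB _ hx)

lemma integral_convexComb_le {μ : Measure Ω} [IsFiniteMeasure μ] (hv : Continuous v)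
    (hc : ConvexOn ℝ Set.univ v) {u w : Ω → ℝ} (hu : AEStronglyMeasurable u μ)
    (hw : AEStronglyMeasurable w μ) (hu' : ∀ᵐ x ∂μ, u x ∈ Set.Icc lo hi)
    (hw' : ∀ᵐ x ∂μ, w x ∈ Set.Icc lo hi) {a b : ℝ} (ha : 0 ≤ a) (hb : 0 ≤ b) (hab : a + b = 1) :
    ∫ x, v (a * u x + b * w x) ∂μ ≤ a * ∫ x, v (u x) ∂μ + b * ∫ x, v (w x) ∂μ := by
  have h1 := integrable_comp_of_mem_Icc hv hu hu'
  have h2 := integrable_comp_of_mem_Icc hv hw hw'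
  rw [← integral_const_mul, ← integral_const_mul,
    ← integral_add (h1.const_mul a) (h2.const_mul b)]
  refine integral_mono_ae ?_ ((h1.const_mul a).add (h2.const_mul b)) (ae_of_all _ fun x =>
    hc.2 (Set.mem_univ _) (Set.mem_univ _) ha hb hab)
  refine integrable_comp_of_mem_Icc (lo := lo) (hi := hi) hv
    ((hu.const_mul a).add (hw.const_mul b)) ?_
  filter_upwards [hu', hw'] with x hx hy
  exact convex_Icc lo hi hx hy ha hb hab

lemma integral_convexComb {μ : Measure Ω} [IsFiniteMeasure μ] {u w : Ω → ℝ}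
    (hu : AEStronglyMeasurable u μ) (hw : AEStronglyMeasurable w μ)
    (hu' : ∀ᵐ x ∂μ, u x ∈ Set.Icc lo hi) (hw' : ∀ᵐ x ∂μ, w x ∈ Set.Icc lo hi) (a b : ℝ) :
    ∫ x, (a * u x + b * w x) ∂μ = a * ∫ x, u x ∂μ + b * ∫ x, w x ∂μ := by
  have h1 := integrable_comp_of_mem_Icc continuous_id hu hu'
  have h2 := integrable_comp_of_mem_Icc continuous_id hw hw'
  rw [← integral_const_mul, ← integral_const_mul]
  exact integral_add (h1.const_mul a) (h2.const_mul b)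

/-- The square-integrable functions with values in `[lo, hi]`. -/
def boundedLp (ν : Measure Ω) (lo hi : ℝ) : Set (Lp ℝ 2 ν) :=
  {u | ∀ᵐ x ∂ν, u x ∈ Set.Icc lo hi}

lemma ae_mem_Icc_of_mem_boundedLp {ν : Measure Ω} {u : Lp ℝ 2 ν} (hu : u ∈ boundedLp ν lo hi) :
    ∀ᵐ x ∂ν, u x ∈ Set.Icc lo hi := hu

lemma exists_seq_tendsto_ae_of_tendsto_Lp {ν : Measure Ω} {u : ℕ → Lp ℝ 2 ν} {u₀ : Lp ℝ 2 ν}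
    (h : Tendsto u atTop (𝓝 u₀)) :
    ∃ ns : ℕ → ℕ, StrictMono ns ∧
      ∀ᵐ x ∂ν, Tendsto (fun k => u (ns k) x) atTop (𝓝 (u₀ x)) :=
  (tendstoInMeasure_of_tendsto_Lp h).exists_seq_tendsto_ae

lemma isClosed_boundedLp (ν : Measure Ω) : IsClosed (boundedLp ν lo hi) := by
  refine IsSeqClosed.isClosed fun u u₀ hu h => ?_
  obtain ⟨ns, -, hns⟩ := exists_seq_tendsto_ae_of_tendsto_Lp h
  filter_upwards [hns, ae_all_iff.2 hu] with x hx hmem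
  exact isClosed_Icc.mem_of_tendsto hx (Eventually.of_forall fun k => hmem _)

lemma coeFn_convexComb {ν : Measure Ω} (a b : ℝ) (u w : Lp ℝ 2 ν) :
    ∀ᵐ x ∂ν, (a • u + b • w : Lp ℝ 2 ν) x = a * u x + b * w x := by
  filter_upwards [Lp.coeFn_add (a • u) (b • w), Lp.coeFn_smul a u, Lp.coeFn_smul b w]
    with x h1 h2 h3
  rw [h1, Pi.add_apply, h2, h3]
  rfl

lemma convex_boundedLp (ν : Measure Ω) : Convex ℝ (boundedLp ν lo hi) := by
  intro u hu w hw a b ha hb hab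
  filter_upwards [hu, hw, coeFn_convexComb a b u w] with x h1 h2 h3
  rw [h3]
  exact convex_Icc lo hi h1 h2 ha hb hab

/-- Convergence in `L²` yields a.e. convergence along a subsequence, and the values stay in a
compact interval, so dominated convergence applies. Absolute continuity suffices to transfer a.e.
statements from `ν` to `μ`. -/
lemma continuousOn_integral_comp {ν μ : Measure Ω} [IsFiniteMeasure μ] (hμ : μ ≪ ν)
    (hv : Continuous v) :
    ContinuousOn (fun u : Lp ℝ 2 ν => ∫ x, v (u x) ∂μ) (boundedLp ν lo hi) := by
  obtain ⟨B, hB⟩ := (isCompact_Icc (a := lo) (b := hi)).exists_bound_of_continuousOn hv.continuousOn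
  rw [continuousOn_iff_continuous_domRestrict, continuous_iff_seqContinuous]
  intro u u₀ h
  refine tendsto_of_subseq_tendsto fun ms hms => ?_
  obtain ⟨ns, -, hns⟩ := exists_seq_tendsto_ae_of_tendsto_Lp
    (((continuous_subtype_val.tendsto u₀).comp h).comp hms)
  refine ⟨ns, tendsto_integral_of_dominated_convergence (fun _ => B) (fun k => ?_)
    (integrable_const B) (fun k => ?_) ?_⟩
  · exact hv.comp_aestronglyMeasurable (Lp.stronglyMeasurable _).aestronglyMeasurable
  · exact hμ.ae_le ((ae_mem_Icc_of_mem_boundedLp (u (ms (ns k))).2).mono fun x hx => hB _ hx)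
  · exact hμ.ae_le (hns.mono fun x hx => (hv.tendsto _).comp hx)

/-- The pairs of a vector of conditional means and of an upper bound of the expected cost which are
attained by measurable transfers with values in `[lo, hi]`. -/
def outcomes (μ : ι → Measure Ω) (w : ι → ℝ) (v : ℝ → ℝ) (lo hi : ℝ) : Set ((ι → ℝ) × ℝ) :=
  {z | ∃ t : Ω → ℝ, Measurable t ∧ (∀ x, t x ∈ Set.Icc lo hi) ∧ (∀ i, ∫ x, t x ∂(μ i) = z.1 i) ∧
    ∑ i, w i * ∫ x, v (t x) ∂(μ i) ≤ z.2}

variable {w : ι → ℝ}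

lemma convex_outcomes (μ : ι → Measure Ω) [∀ i, IsFiniteMeasure (μ i)]
    (hw : ∀ i, 0 ≤ w i) (hv : Continuous v) (hc : ConvexOn ℝ Set.univ v) :
    Convex ℝ (outcomes μ w v lo hi) := by
  rintro z ⟨t, ht, htm, hz1, hz2⟩ z' ⟨t', ht', htm', hz1', hz2'⟩ a b ha hb hab
  refine ⟨fun x => a * t x + b * t' x, (ht.const_mul a).add (ht'.const_mul b),
    fun x => convex_Icc lo hi (htm x) (htm' x) ha hb hab, fun i => ?_, ?_⟩
  · rw [integral_convexComb ht.aestronglyMeasurable ht'.aestronglyMeasurable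
      (ae_of_all _ htm) (ae_of_all _ htm'), hz1, hz1']
    rfl
  · calc ∑ i, w i * ∫ x, v (a * t x + b * t' x) ∂(μ i)
        ≤ ∑ i, w i * (a * ∫ x, v (t x) ∂(μ i) + b * ∫ x, v (t' x) ∂(μ i)) :=
          Finset.sum_le_sum fun i _ => mul_le_mul_of_nonneg_left
            (integral_convexComb_le hv hc ht.aestronglyMeasurable ht'.aestronglyMeasurable
              (ae_of_all _ htm) (ae_of_all _ htm') ha hb hab) (hw i)
      _ = a * ∑ i, w i * ∫ x, v (t x) ∂(μ i) + b * ∑ i, w i * ∫ x, v (t' x) ∂(μ i) := by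
          rw [Finset.mul_sum, Finset.mul_sum, ← Finset.sum_add_distrib]
          exact Finset.sum_congr rfl fun i _ => by ring
      _ ≤ a * z.2 + b * z'.2 := by gcongr

/-- The elements of `boundedLp` whose outcome is within `ε` of `z`. -/
def nearOutcome (μ : ι → Measure Ω) (ν : Measure Ω) (w : ι → ℝ) (v : ℝ → ℝ) (lo hi : ℝ) (z : (ι → ℝ) × ℝ) (ε : ℝ) :
    Set (Lp ℝ 2 ν) :=
  {u | u ∈ boundedLp ν lo hi ∧ (∀ i, ∫ x, u x ∂(μ i) ∈ Set.Icc (z.1 i - ε) (z.1 i + ε)) ∧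
    ∑ i, w i * ∫ x, v (u x) ∂(μ i) ≤ z.2 + ε}

lemma isClosed_nearOutcome (μ : ι → Measure Ω) [∀ i, IsFiniteMeasure (μ i)]
    {ν : Measure Ω} (hμ : ∀ i, μ i ≪ ν) (hv : Continuous v)
    (z : (ι → ℝ) × ℝ) (ε : ℝ) : IsClosed (nearOutcome μ ν w v lo hi z ε) := by
  have h1 : ∀ i, IsClosed (boundedLp ν lo hi ∩
      (fun u : Lp ℝ 2 ν => ∫ x, u x ∂(μ i)) ⁻¹' Set.Icc (z.1 i - ε) (z.1 i + ε)) := fun i =>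
    (continuousOn_integral_comp (hμ i) continuous_id).preimage_isClosed_of_isClosed
      (isClosed_boundedLp ν) isClosed_Icc
  have h2 : IsClosed (boundedLp ν lo hi ∩
      (fun u : Lp ℝ 2 ν => ∑ i, w i * ∫ x, v (u x) ∂(μ i)) ⁻¹' Set.Iic (z.2 + ε)) :=
    (continuousOn_finsetSum _ fun i _ =>
      (continuousOn_integral_comp (hμ i) hv).const_mul (w i)).preimage_isClosed_of_isClosed
      (isClosed_boundedLp ν) isClosed_Iic
  convert (isClosed_iInter h1).inter h2 using 1
  ext u
  simp only [nearOutcome, Set.mem_ofPred_eq, Set.mem_inter_iff, Set.mem_iInter, Set.mem_preimage,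
    Set.mem_Iic]
  exact ⟨fun h => ⟨fun i => ⟨h.1, h.2.1 i⟩, h.1, h.2.2⟩,
    fun h => ⟨h.2.1, fun i => (h.1 i).2, h.2.2⟩⟩

lemma convex_nearOutcome (μ : ι → Measure Ω) [∀ i, IsFiniteMeasure (μ i)]
    {ν : Measure Ω} (hμ : ∀ i, μ i ≪ ν) (hw : ∀ i, 0 ≤ w i)
    (hv : Continuous v) (hc : ConvexOn ℝ Set.univ v) (z : (ι → ℝ) × ℝ) (ε : ℝ) :
    Convex ℝ (nearOutcome μ ν w v lo hi z ε) := by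
  rintro u ⟨hu, hu1, hu2⟩ u' ⟨hu', hu1', hu2'⟩ a b ha hb hab
  have hmeas : ∀ (f : Lp ℝ 2 ν) i, AEStronglyMeasurable f (μ i) := fun f i =>
    (Lp.stronglyMeasurable f).aestronglyMeasurable
  have hcomb : ∀ i, ∀ᵐ x ∂(μ i), (a • u + b • u' : Lp ℝ 2 ν) x = a * u x + b * u' x := fun i =>
    (hμ i).ae_le (coeFn_convexComb a b u u')
  refine ⟨convex_boundedLp ν hu hu' ha hb hab, fun i => ?_, ?_⟩
  · rw [integral_congr_ae (hcomb i), integral_convexComb (hmeas u i) (hmeas u' i)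
      ((hμ i).ae_le hu) ((hμ i).ae_le hu')]
    exact convex_Icc _ _ (hu1 i) (hu1' i) ha hb hab
  · calc ∑ i, w i * ∫ x, v ((a • u + b • u' : Lp ℝ 2 ν) x) ∂(μ i)
        ≤ ∑ i, w i * (a * ∫ x, v (u x) ∂(μ i) + b * ∫ x, v (u' x) ∂(μ i)) := by
          refine Finset.sum_le_sum fun i _ => mul_le_mul_of_nonneg_left ?_ (hw i)
          rw [integral_congr_ae ((hcomb i).mono fun x hx => congrArg v hx)]
          exact integral_convexComb_le hv hc (hmeas u i) (hmeas u' i)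
            ((hμ i).ae_le hu) ((hμ i).ae_le hu') ha hb hab
      _ = a * ∑ i, w i * ∫ x, v (u x) ∂(μ i) + b * ∑ i, w i * ∫ x, v (u' x) ∂(μ i) := by
          rw [Finset.mul_sum, Finset.mul_sum, ← Finset.sum_add_distrib]
          exact Finset.sum_congr rfl fun i _ => by ring
      _ ≤ a * (z.2 + ε) + b * (z.2 + ε) := by gcongr
      _ = z.2 + ε := by rw [← add_mul, hab, one_mul]

lemma nonempty_nearOutcome (μ : ι → Measure Ω) {ν : Measure Ω} [IsFiniteMeasure ν] (hμ : ∀ i, μ i ≪ ν)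
    {z : (ι → ℝ) × ℝ} (hz : z ∈ closure (outcomes μ w v lo hi)) {ε : ℝ} (hε : 0 < ε) :
    (nearOutcome μ ν w v lo hi z ε).Nonempty := by
  obtain ⟨z', ⟨t, ht, htm, hz1, hz2⟩, hd⟩ := Metric.mem_closure_iff.1 hz ε hε
  have hmem : MemLp t 2 ν := by
    refine MemLp.of_bound ht.aestronglyMeasurable (max |lo| |hi|) (ae_of_all _ fun x => ?_)
    exact abs_le_max_abs_abs (htm x).1 (htm x).2
  have hcoe : ∀ i, ∀ᵐ x ∂(μ i), hmem.toLp t x = t x := fun i => (hμ i).ae_le hmem.coeFn_toLp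
  rw [Prod.dist_eq, max_lt_iff] at hd
  refine ⟨hmem.toLp t, ?_, fun i => ?_, ?_⟩
  · filter_upwards [hmem.coeFn_toLp] with x hx
    rw [hx]
    exact htm x
  · rw [integral_congr_ae (hcoe i), hz1]
    have := (dist_le_pi_dist z.1 z'.1 i).trans_lt hd.1
    rw [Real.dist_eq, abs_lt] at this
    constructor <;> linarith [this.1, this.2]
  · have h2 := hd.2
    rw [Real.dist_eq, abs_lt] at h2
    calc ∑ i, w i * ∫ x, v (hmem.toLp t x) ∂(μ i) = ∑ i, w i * ∫ x, v (t x) ∂(μ i) :=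
          Finset.sum_congr rfl fun i _ => by
            rw [integral_congr_ae ((hcoe i).mono fun x hx => congrArg v hx)]
      _ ≤ z.2 + ε := by linarith [h2.1]

/-- For a point of the closure, the transfers attaining it up to `1 / (k + 1)` form nested nonempty
closed convex bounded sets in `L²`; a common element attains it exactly. Convexity of `v` is what
makes the cost constraint survive without strong compactness. -/
lemma isClosed_outcomes (μ : ι → Measure Ω) [∀ i, IsFiniteMeasure (μ i)]
    (hlo : lo ≤ hi) (hw : ∀ i, 0 ≤ w i) (hv : Continuous v)
    (hc : ConvexOn ℝ Set.univ v) : IsClosed (outcomes μ w v lo hi) := by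
  refine isClosed_of_closure_subset fun z hz => ?_
  -- One finite measure dominating all the conditional laws, so that a single `L²` space serves
  -- every state.
  set ν : Measure Ω := ∑ i, μ i
  have hμ : ∀ i, μ i ≪ ν := fun i =>
    Measure.absolutelyContinuous_of_le (Finset.single_le_sum (f := μ)
      (fun j _ => Measure.zero_le _) (Finset.mem_univ i))
  have hanti : Antitone fun k : ℕ => nearOutcome μ ν w v lo hi z (1 / ((k : ℝ) + 1)) := by
    rintro k l hkl u ⟨h1, h2, h3⟩
    have h := Nat.one_div_le_one_div (α := ℝ) hkl
    exact ⟨h1, fun i => Set.Icc_subset_Icc (by linarith) (by linarith) (h2 i), h3.trans (by linarith)⟩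
  obtain ⟨u, hu⟩ := exists_mem_of_antitone_closed_convex hanti
    (fun k => nonempty_nearOutcome μ hμ hz (by positivity))
    (fun k => isClosed_nearOutcome μ hμ hv z _) (fun k => convex_nearOutcome μ hμ hw hv hc z _)
    (R := ‖(measureUnivNNReal ν : ℝ) ^ (ENNReal.toReal 2)⁻¹ * max |lo| |hi|‖) (fun u hu => by
      refine (Lp.norm_le_of_ae_bound (C := max |lo| |hi|) (le_max_of_le_left (abs_nonneg _))
        ((ae_mem_Icc_of_mem_boundedLp hu.1).mono fun x hx => abs_le_max_abs_abs hx.1 hx.2)).trans ?_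
      exact Real.le_norm_self _)
  have hlim : Tendsto (fun k : ℕ => 1 / ((k : ℝ) + 1)) atTop (𝓝 0) :=
    tendsto_one_div_add_atTop_nhds_zero_nat
  -- The element of `L²` respects the bounds only almost everywhere; truncating it enforces them at
  -- every signal without changing any integral.
  have hcoe : ∀ i, ∀ᵐ x ∂(μ i), max lo (min hi (u x)) = u x := fun i =>
    (hμ i).ae_le ((ae_mem_Icc_of_mem_boundedLp (hu 0).1).mono fun x hx => by
      rw [min_eq_right hx.2, max_eq_right hx.1])
  refine ⟨fun x => max lo (min hi (u x)),
    measurable_const.max (measurable_const.min (Lp.stronglyMeasurable u).measurable),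
    fun x => ⟨le_max_left _ _, max_le hlo (min_le_left _ _)⟩, fun i => ?_, ?_⟩
  · rw [integral_congr_ae (hcoe i)]
    refine le_antisymm ?_ ?_
    · exact ge_of_tendsto' (by simpa using tendsto_const_nhds.add hlim)
        (fun k => ((hu k).2.1 i).2)
    · exact le_of_tendsto' (by simpa using (tendsto_const_nhds (x := z.1 i)).sub hlim)
        (fun k => ((hu k).2.1 i).1)
  · have : ∀ k : ℕ, ∑ i, w i * ∫ x, v (max lo (min hi (u x))) ∂(μ i)
        ≤ z.2 + 1 / ((k : ℝ) + 1) := fun k => by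
      refine le_trans (le_of_eq (Finset.sum_congr rfl fun i _ => ?_)) (hu k).2.2
      rw [integral_congr_ae ((hcoe i).mono fun x hx => congrArg v hx)]
    exact ge_of_tendsto' (by simpa using tendsto_const_nhds.add hlim) this

end Outcomes

/-! ### Replicating transfers under the dominating experiment -/

section Replication

variable {n : ℕ} {lo hi : ℝ} {v : ℝ → ℝ}

/-- The minimizers of `s * z + v s` over `[lo, hi]` can be chosen antitone in `z`. -/
lemma exists_antitone_minimizer (hlo : lo ≤ hi) (hv : Continuous v) :
    ∃ σ : ℝ → ℝ, Antitone σ ∧ (∀ z, σ z ∈ Set.Icc lo hi) ∧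
      ∀ z, ∀ s ∈ Set.Icc lo hi, σ z * z + v (σ z) ≤ s * z + v s := by
  have h : ∀ z : ℝ, ∃ s ∈ Set.Icc lo hi, ∀ s' ∈ Set.Icc lo hi, s * z + v s ≤ s' * z + v s' := by
    intro z
    have hcont : ContinuousOn (fun s => s * z + v s) (Set.Icc lo hi) := by fun_prop
    obtain ⟨s, hs, hs'⟩ := isCompact_Icc.exists_isMinOn (Set.nonempty_Icc.2 hlo) hcont
    exact ⟨s, hs, fun s' h' => hs' h'⟩
  choose σ hσ hmin using h
  refine ⟨σ, fun z z' hz => ?_, hσ, hmin⟩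
  rcases hz.eq_or_lt with rfl | hz
  · exact le_rfl
  · have h1 := hmin z _ (hσ z')
    have h2 := hmin z' _ (hσ z)
    -- Adding the two optimality inequalities gives `(σ z' - σ z) * (z' - z) ≤ 0`. Monotonicity is
    -- wanted because it makes the chosen minimizer measurable.
    by_contra! h3
    nlinarith [mul_pos (sub_pos.2 h3) (sub_pos.2 hz)]

/-- The minimum over `s` of functions affine in `z` is concave. The shift `κ` absorbs the constant
term of the affine function of the posterior. -/
lemma convexOn_neg_min {σ : ℝ → ℝ} (hσ : ∀ z, σ z ∈ Set.Icc lo hi)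
    (hmin : ∀ z, ∀ s ∈ Set.Icc lo hi, σ z * z + v (σ z) ≤ s * z + v s) (κ : ℝ) :
    ConvexOn ℝ Set.univ fun r => -(σ (κ + r) * (κ + r) + v (σ (κ + r))) := by
  refine ⟨convex_univ, fun x _ y _ a b ha hb hab => ?_⟩
  simp only [smul_eq_mul]
  set s := σ (κ + (a * x + b * y))
  have h1 := mul_le_mul_of_nonneg_left (hmin (κ + x) s (hσ _)) ha
  have h2 := mul_le_mul_of_nonneg_left (hmin (κ + y) s (hσ _)) hb
  have h3 : s * (κ + (a * x + b * y)) + v s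
      = a * (s * (κ + x) + v s) + b * (s * (κ + y) + v s) := by
    linear_combination (-(s * κ) - v s) * hab
  rw [h3]
  linarith

/-- Write `lᵢ fᵢ` as `(lᵢ / wᵢ) (wᵢ fᵢ)`, the second factor being posterior times mixture density,
and eliminate the posterior probability of `θ₀` as one minus the others. The divisions are why the
weights must be positive. -/
lemma Experiment.mixDensity_mul_affine_posterior (F : Experiment n) {w : Fin (n + 1) → ℝ}
    (hw : ∀ i, 0 < w i) (hw1 : ∑ i, w i = 1) (l : Fin (n + 1) → ℝ) (x : F.Signal) :
    F.mixDensity (fun i => w i.succ) x * (l 0 / w 0 + ∑ i : Fin n,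
        (l i.succ / w i.succ - l 0 / w 0) * F.posterior (fun i => w i.succ) x i)
      = ∑ i, l i * F.density i x := by
  have hq := comp_succ_mem_beliefs (fun i => (hw i).le) hw1
  have h0 := (hw 0).ne'
  have h1 : ∀ i : Fin n, F.mixDensity (fun i => w i.succ) x *
      ((l i.succ / w i.succ - l 0 / w 0) * F.posterior (fun i => w i.succ) x i)
      = l i.succ * F.density i.succ x - l 0 / w 0 * (w i.succ * F.density i.succ x) := by
    intro i
    have := (hw i.succ).ne'
    rw [mul_left_comm, F.mixDensity_mul_posterior hq]
    field_simp
  rw [mul_add, Finset.mul_sum, Finset.sum_congr rfl fun i _ => h1 i, Finset.sum_sub_distrib,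
    ← Finset.mul_sum, Experiment.mixDensity, stateProb_comp_succ hw1, Fin.sum_univ_succ,
    Fin.sum_univ_succ]
  field_simp
  ring

lemma Experiment.lagrangian_eq (F : Experiment n) {w : Fin (n + 1) → ℝ} (hw : ∀ i, 0 < w i)
    (hw1 : ∑ i, w i = 1) (l : Fin (n + 1) → ℝ) (hv : Continuous v) {t : F.Signal → ℝ}
    (ht : Measurable t) (htm : ∀ x, t x ∈ Set.Icc lo hi) :
    (∑ i, l i * ∫ x, t x ∂(F.law i)) + ∑ i, w i * ∫ x, v (t x) ∂(F.law i)
      = ∫ x, (t x * (l 0 / w 0 + ∑ i : Fin n, (l i.succ / w i.succ - l 0 / w 0) *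
          F.posterior (fun i => w i.succ) x i) + v (t x)) ∂(F.mixLaw fun i => w i.succ) := by
  have hq := comp_succ_mem_beliefs (fun i => (hw i).le) hw1
  obtain ⟨B, hB⟩ := (isCompact_Icc (a := lo) (b := hi)).exists_bound_of_continuousOn hv.continuousOn
  have htb : ∀ x, |t x| ≤ max |lo| |hi| := fun x => abs_le_max_abs_abs (htm x).1 (htm x).2
  have hvt : Measurable fun x => v (t x) := hv.measurable.comp ht
  have hvb : ∀ x, |v (t x)| ≤ B := fun x => hB _ (htm x)
  rw [F.sum_mul_integral_law l ht htb, F.sum_mul_integral_law w hvt hvb, F.integral_mixLaw hq,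
    ← integral_add]
  · refine integral_congr_ae (ae_of_all _ fun x => ?_)
    simp only
    rw [mul_add, mul_left_comm, F.mixDensity_mul_affine_posterior hw hw1, Experiment.mixDensity,
      stateProb_comp_succ hw1, mul_comm (t x)]
  · simp_rw [Finset.sum_mul, mul_assoc]
    exact integrable_finsetSum _ fun i _ => (F.integrable_density_mul i ht htb).const_mul _
  · simp_rw [Finset.sum_mul, mul_assoc]
    exact integrable_finsetSum _ fun i _ => (F.integrable_density_mul i hvt hvb).const_mul _

lemma Experiment.integrable_lagrangian (F : Experiment n) {q : Fin n → ℝ} (hq : q ∈ beliefs n)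
    (κ : ℝ) (b : Fin n → ℝ) (hv : Continuous v) {t : F.Signal → ℝ}
    (ht : Measurable t) (htm : ∀ x, t x ∈ Set.Icc lo hi) :
    Integrable (fun x => t x * (κ + ∑ i, b i * F.posterior q x i) + v (t x)) (F.mixLaw q) := by
  have := F.isProbabilityMeasure_mixLaw hq
  have hm : Measurable fun x => κ + ∑ i, b i * F.posterior q x i :=
    measurable_const.add (F.measurable_sum_mul_posterior q b)
  refine Integrable.add ?_
    (integrable_comp_of_mem_Icc hv ht.aestronglyMeasurable (ae_of_all _ htm))
  refine Integrable.of_bound (ht.mul hm).aestronglyMeasurable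
    (max |lo| |hi| * (|κ| + ∑ i, |b i|)) (ae_of_all _ fun x => ?_)
  rw [Real.norm_eq_abs, abs_mul]
  refine mul_le_mul (abs_le_max_abs_abs (htm x).1 (htm x).2) ?_ (abs_nonneg _)
    (le_max_of_le_left (abs_nonneg _))
  exact (abs_add_le _ _).trans (by gcongr; exact F.abs_sum_mul_posterior_le hq b x)

/-- With `w` as prior, the Lagrangian is the mean of `t * z + v t`, where `z` is affine in the
posterior. Choosing the pointwise minimizer under `F` gives the mean of a concave function of `z`;
by dominance this is at most the minimum under `G`, hence at most the value of `t`. -/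
lemma exists_transfer_lagrangian_le_of_sum_eq_one {F G : Experiment n} (h : F.LBDominates G)
    (hlo : lo ≤ hi) (hv : Continuous v) {w : Fin (n + 1) → ℝ} (hw : ∀ i, 0 < w i)
    (hw1 : ∑ i, w i = 1) (l : Fin (n + 1) → ℝ) {t : G.Signal → ℝ} (ht : Measurable t)
    (htm : ∀ x, t x ∈ Set.Icc lo hi) :
    ∃ t' : F.Signal → ℝ, Measurable t' ∧ (∀ x, t' x ∈ Set.Icc lo hi) ∧
      (∑ i, l i * ∫ x, t' x ∂(F.law i)) + ∑ i, w i * ∫ x, v (t' x) ∂(F.law i)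
        ≤ (∑ i, l i * ∫ x, t x ∂(G.law i)) + ∑ i, w i * ∫ x, v (t x) ∂(G.law i) := by
  have hq := comp_succ_mem_beliefs (fun i => (hw i).le) hw1
  obtain ⟨σ, hσ, hσm, hmin⟩ := exists_antitone_minimizer hlo hv
  set κ := l 0 / w 0
  set b : Fin n → ℝ := fun i => l i.succ / w i.succ - κ
  have hmF : Measurable fun x => σ (κ + ∑ i, b i * F.posterior (fun i => w i.succ) x i) :=
    hσ.measurable.comp (measurable_const.add (F.measurable_sum_mul_posterior _ b))
  have hmG : Measurable fun x => σ (κ + ∑ i, b i * G.posterior (fun i => w i.succ) x i) :=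
    hσ.measurable.comp (measurable_const.add (G.measurable_sum_mul_posterior _ b))
  refine ⟨_, hmF, fun x => hσm _, ?_⟩
  rw [F.lagrangian_eq hw hw1 l hv hmF fun x => hσm _, G.lagrangian_eq hw hw1 l hv ht htm]
  have hC := h _ hq b _ (convexOn_neg_min hσm hmin κ)
  rw [integral_neg, integral_neg, neg_le_neg_iff] at hC
  refine hC.trans (integral_mono (G.integrable_lagrangian hq κ b hv hmG fun x => hσm _)
    (G.integrable_lagrangian hq κ b hv ht htm) fun x => hmin _ _ (htm x))

/-- The inequality is homogeneous in `(l, w)`, so the weights can be normalized to a prior. -/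
lemma exists_transfer_lagrangian_le {F G : Experiment n} (h : F.LBDominates G)
    (hlo : lo ≤ hi) (hv : Continuous v) {w : Fin (n + 1) → ℝ} (hw : ∀ i, 0 < w i)
    (l : Fin (n + 1) → ℝ) {t : G.Signal → ℝ} (ht : Measurable t)
    (htm : ∀ x, t x ∈ Set.Icc lo hi) :
    ∃ t' : F.Signal → ℝ, Measurable t' ∧ (∀ x, t' x ∈ Set.Icc lo hi) ∧
      (∑ i, l i * ∫ x, t' x ∂(F.law i)) + ∑ i, w i * ∫ x, v (t' x) ∂(F.law i)
        ≤ (∑ i, l i * ∫ x, t x ∂(G.law i)) + ∑ i, w i * ∫ x, v (t x) ∂(G.law i) := by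
  have hW : 0 < ∑ i, w i := Finset.sum_pos (fun i _ => hw i) Finset.univ_nonempty
  obtain ⟨t', ht', htm', hle⟩ := exists_transfer_lagrangian_le_of_sum_eq_one h hlo hv
    (w := fun i => w i / ∑ j, w j) (fun i => div_pos (hw i) hW)
    (by rw [← Finset.sum_div, div_self hW.ne']) (fun i => l i / ∑ j, w j) ht htm
  refine ⟨t', ht', htm', ?_⟩
  simp_rw [div_mul_eq_mul_div] at hle
  rw [← Finset.sum_div, ← Finset.sum_div, ← Finset.sum_div, ← Finset.sum_div, ← add_div,
    ← add_div] at hle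
  exact (div_le_div_iff_of_pos_right hW).1 hle

lemma continuousLinearMap_apply_pi_prod {ι : Type*} [Fintype ι] [DecidableEq ι]
    (f : (ι → ℝ) × ℝ →L[ℝ] ℝ) (z : (ι → ℝ) × ℝ) :
    f z = ∑ i, f (Pi.single i 1, 0) * z.1 i + f (0, 1) * z.2 := by
  have h : z = ∑ i, z.1 i • ((Pi.single i 1 : ι → ℝ), (0 : ℝ)) + z.2 • ((0 : ι → ℝ), (1 : ℝ)) := by
    refine Prod.ext ?_ ?_
    · funext j
      simp [Prod.fst_sum, Finset.sum_apply, Pi.single_apply]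
    · simp [Prod.snd_sum]
  have h' := congrArg f h
  rw [map_add, map_sum, map_smul, smul_eq_mul, mul_comm z.2] at h'
  rw [h']
  congr 1
  exact Finset.sum_congr rfl fun i _ => by rw [map_smul, smul_eq_mul, mul_comm]

/-- If `F` dominates `G` in the linear-Blackwell order, then every transfer rule contingent on the
signal of `G` can be replaced by one contingent on the signal of `F` with the same expectation in
each state and a weakly lower expected cost. -/
theorem Experiment.LBDominates.exists_transfer {F G : Experiment n} (h : F.LBDominates G)
    (hlo : lo ≤ hi) (hv : Continuous v) (hc : ConvexOn ℝ Set.univ v) {w : Fin (n + 1) → ℝ}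
    (hw : ∀ i, 0 ≤ w i) {t : G.Signal → ℝ} (ht : Measurable t)
    (htm : ∀ x, t x ∈ Set.Icc lo hi) :
    ∃ t' : F.Signal → ℝ, Measurable t' ∧ (∀ x, t' x ∈ Set.Icc lo hi) ∧
      (∀ i, ∫ x, t' x ∂(F.law i) = ∫ x, t x ∂(G.law i)) ∧
      ∑ i, w i * ∫ x, v (t' x) ∂(F.law i) ≤ ∑ i, w i * ∫ x, v (t x) ∂(G.law i) := by
  set z : (Fin (n + 1) → ℝ) × ℝ :=
    (fun i => ∫ x, t x ∂(G.law i), ∑ i, w i * ∫ x, v (t x) ∂(G.law i))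
  change z ∈ outcomes F.law w v lo hi
  by_contra hz
  obtain ⟨f, u, hfz, hfu⟩ := geometric_hahn_banach_point_closed
    (convex_outcomes F.law hw hv hc) (isClosed_outcomes F.law hlo hw hv hc) hz
  rw [continuousLinearMap_apply_pi_prod] at hfz
  replace hfu : ∀ y ∈ outcomes F.law w v lo hi,
      u < ∑ i, f (Pi.single i 1, 0) * y.1 i + f (0, 1) * y.2 := fun y hy => by
    rw [← continuousLinearMap_apply_pi_prod]
    exact hfu y hy
  set l : Fin (n + 1) → ℝ := fun i => f (Pi.single i 1, 0)
  set m := f (0, 1)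
  -- The cost coordinate can be raised freely. Were `m` negative, raising it by `|A| / (-m)` would
  -- bring the functional down to at most `u` on the set.
  have hm : 0 ≤ m := by
    by_contra! hm
    set y : Fin (n + 1) → ℝ := fun i => ∫ _, lo ∂(F.law i)
    set c := ∑ i, w i * ∫ _, v lo ∂(F.law i)
    set A := ∑ i, l i * y i + m * c - u
    have := hfu (y, c + |A| / (-m)) ⟨fun _ => lo, measurable_const, fun _ => ⟨le_rfl, hlo⟩,
      fun _ => rfl, le_add_of_nonneg_right (div_nonneg (abs_nonneg _) (by linarith))⟩
    have h2 : m * (c + |A| / (-m)) = m * c - |A| := by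
      have := hm.ne
      field_simp
      ring
    simp only [h2] at this
    have h3 := le_abs_self A
    simp only [A] at h3 this
    linarith
  obtain ⟨B, hB⟩ := (isCompact_Icc (a := lo) (b := hi)).exists_bound_of_continuousOn hv.continuousOn
  have hB0 : 0 ≤ B := (norm_nonneg _).trans (hB lo ⟨le_rfl, hlo⟩)
  have hbound : ∀ (E : Experiment n) (s : E.Signal → ℝ), (∀ x, s x ∈ Set.Icc lo hi) → ∀ i,
      |∫ x, v (s x) ∂(E.law i)| ≤ B := fun E s hs i => by
    simpa using norm_integral_le_of_norm_le_const (μ := E.law i) (ae_of_all _ fun x => hB _ (hs x))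
  set N : ℝ := (n : ℝ) + 1
  have hN : 0 < N := by positivity
  set g := u - (∑ i, l i * z.1 i + m * z.2)
  have hg : 0 < g := sub_pos.2 hfz
  -- The weights `m * w i` may vanish, so `ε` is added to each. This changes the comparison of the
  -- two Lagrangians by at most `ε * (N * (2 * B))`, which is less than the separation gap `g`.
  set ε := g / (N * (2 * B) + 1)
  have hε : 0 < ε := by positivity
  have hεg : ε * (N * (2 * B)) < g := by
    have : ε * (N * (2 * B) + 1) = g := div_mul_cancel₀ _ (by positivity)
    linarith
  obtain ⟨t', ht', htm', hle⟩ := exists_transfer_lagrangian_le h hlo hv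
    (w := fun i => m * w i + ε) (fun i => add_pos_of_nonneg_of_pos (mul_nonneg hm (hw i)) hε)
    l ht htm
  have h1 := hfu (fun i => ∫ x, t' x ∂(F.law i), ∑ i, w i * ∫ x, v (t' x) ∂(F.law i))
    ⟨t', ht', htm', fun _ => rfl, le_rfl⟩
  have hsplit : ∀ c : Fin (n + 1) → ℝ,
      ∑ i, (m * w i + ε) * c i = m * ∑ i, w i * c i + ε * ∑ i, c i := fun c => by
    rw [Finset.mul_sum, Finset.mul_sum, ← Finset.sum_add_distrib]
    exact Finset.sum_congr rfl fun i _ => by ring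
  rw [hsplit, hsplit] at hle
  have h2 : ∑ i, ∫ x, v (t x) ∂(G.law i) ≤ N * B := by
    refine (Finset.sum_le_card_nsmul _ _ B
      fun i _ => (le_abs_self _).trans (hbound G t htm i)).trans (le_of_eq ?_)
    simp [N]
  have h3 : -(N * B) ≤ ∑ i, ∫ x, v (t' x) ∂(F.law i) := by
    refine le_trans (le_of_eq ?_) (Finset.card_nsmul_le_sum _ _ (-B)
      fun i _ => (abs_le.1 (hbound F t' htm' i)).1)
    simp [N]
  have h4 := mul_le_mul_of_nonneg_left h2 hε.le
  have h5 := mul_le_mul_of_nonneg_left h3 hε.le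
  simp only [g, z] at h1 hεg
  linarith

end Replication

/-! ### Dominance raises the optimal value -/

namespace ScreeningEnvironment

variable {n : ℕ} (E : ScreeningEnvironment n)

lemma integral_exPostLaw (F : Experiment n) (a : Fin (E.k + 1)) (i : Fin (n + 1))
    {g : F.Signal ⊕ Unit → ℝ} (hg : Measurable g) {B : ℝ} (hB : ∀ s, |g s| ≤ B) :
    ∫ s, g s ∂(E.exPostLaw F a i)
      = E.psi a * ∫ x, g (Sum.inl x) ∂(F.law i) + (1 - E.psi a) * g (Sum.inr ()) := by
  have hp := E.psi_mem a
  have : IsProbabilityMeasure ((F.law i).map (Sum.inl : F.Signal → F.Signal ⊕ Unit)) :=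
    Measure.isProbabilityMeasure_map measurable_inl.aemeasurable
  have hint : ∀ (μ : Measure (F.Signal ⊕ Unit)) [IsFiniteMeasure μ], Integrable g μ := fun μ _ =>
    Integrable.of_bound hg.aestronglyMeasurable B (ae_of_all _ hB)
  rw [exPostLaw, integral_add_measure ((hint _).smul_measure ENNReal.ofReal_ne_top)
    ((hint _).smul_measure ENNReal.ofReal_ne_top), integral_smul_measure, integral_smul_measure,
    integral_map measurable_inl.aemeasurable hg.aestronglyMeasurable,
    integral_dirac' _ _ hg.stronglyMeasurable, ENNReal.toReal_ofReal hp.1,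
    ENNReal.toReal_ofReal (sub_nonneg.2 hp.2)]
  rfl

lemma Mechanism.integral_comp_transfer {E : ScreeningEnvironment n} {F : Experiment n}
    (M : E.Mechanism F) (p : E.types) (a : Fin (E.k + 1)) (i : Fin (n + 1)) {v : ℝ → ℝ}
    (hv : Continuous v) :
    ∫ s, v (M.transfer p a s) ∂(E.exPostLaw F a i)
      = E.psi a * ∫ x, v (M.transfer p a (Sum.inl x)) ∂(F.law i)
        + (1 - E.psi a) * v (M.transfer p a (Sum.inr ())) := by
  obtain ⟨B, hB⟩ := (isCompact_Icc (a := E.mLo) (b := E.mHi)).exists_bound_of_continuousOn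
    hv.continuousOn
  exact E.integral_exPostLaw F a i (hv.measurable.comp (M.measurable_transfer p a))
    (fun s => hB _ (M.transfer_mem p a s))

lemma Mechanism.integral_transfer {E : ScreeningEnvironment n} {F : Experiment n}
    (M : E.Mechanism F) (p : E.types) (a : Fin (E.k + 1)) (i : Fin (n + 1)) :
    ∫ s, M.transfer p a s ∂(E.exPostLaw F a i)
      = E.psi a * ∫ x, M.transfer p a (Sum.inl x) ∂(F.law i)
        + (1 - E.psi a) * M.transfer p a (Sum.inr ()) :=
  M.integral_comp_transfer p a i continuous_id

/-- The transfer is replaced separately for each report and alternative, with the reporting type's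
belief as cost weights. Equality of means in every state, not just on average, preserves the payoff
of every type from every report, hence feasibility. -/
lemma optimalValue_le_of_lbDominates {F G : Experiment n} (h : F.LBDominates G) :
    E.optimalValue G ≤ E.optimalValue F := by
  refine iSup₂_le fun M hM => ?_
  have hex : ∀ (p : E.types) a, ∃ t' : F.Signal → ℝ, Measurable t' ∧
      (∀ x, t' x ∈ Set.Icc E.mLo E.mHi) ∧
      (∀ i, ∫ x, t' x ∂(F.law i) = ∫ x, M.transfer p a (Sum.inl x) ∂(G.law i)) ∧
      ∑ i, stateProb (p : Fin n → ℝ) i * ∫ x, E.v₂ (t' x) ∂(F.law i)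
        ≤ ∑ i, stateProb (p : Fin n → ℝ) i *
          ∫ x, E.v₂ (M.transfer p a (Sum.inl x)) ∂(G.law i) := fun p a =>
    h.exists_transfer E.mLo_lt_mHi.le E.continuous_v₂ E.convexOn_v₂
      (stateProb_nonneg (E.types_subset p p.2))
      ((M.measurable_transfer p a).comp measurable_inl) (fun x => M.transfer_mem p a _)
  choose t ht htm hmean hcost using hex
  let M' : E.Mechanism F :=
    { alloc := M.alloc
      alloc_mem := M.alloc_mem
      transfer := fun p a => Sum.elim (t p a) fun _ => M.transfer p a (Sum.inr ())
      measurable_transfer := fun p a => Measurable.sumElim (ht p a) measurable_const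
      transfer_mem := fun p a s => by
        cases s with
        | inl x => exact htm p a x
        | inr _ => exact M.transfer_mem p a _ }
  have hagent : ∀ p p', M'.agentUtility p p' = M.agentUtility p p' := fun p p' => by
    unfold Mechanism.agentUtility
    refine Finset.sum_congr rfl fun a _ => congrArg _ (Finset.sum_congr rfl fun i _ => ?_)
    rw [M'.integral_transfer, M.integral_transfer]
    simp only [M', Sum.elim_inl, Sum.elim_inr, hmean]
  refine le_trans ?_ (le_iSup₂ M' ⟨fun p => (hM.1 p).trans_eq (hagent p p).symm, fun p p' => by
    rw [hagent, hagent]; exact hM.2 p p'⟩)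
  rw [EReal.coe_le_coe_iff]
  refine Finset.sum_le_sum fun p _ => mul_le_mul_of_nonneg_left ?_ (E.typeProb_mem.1 p)
  refine Finset.sum_le_sum fun a _ => mul_le_mul_of_nonneg_left ?_ ((M.alloc_mem p).1 a)
  simp_rw [M.integral_comp_transfer p a _ E.continuous_v₂,
    M'.integral_comp_transfer p a _ E.continuous_v₂]
  simp only [M', Sum.elim_inl, Sum.elim_inr]
  simp_rw [mul_sub, mul_add, Finset.sum_sub_distrib, Finset.sum_add_distrib,
    mul_left_comm _ (E.psi a), ← Finset.mul_sum]
  exact sub_le_sub_left (add_le_add_left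
    (mul_le_mul_of_nonneg_left (hcost p a) (E.psi_mem a).1) _) _

end ScreeningEnvironment

/-! ### Reduction of the order to hinge functions -/

section Hinges

lemma continuous_of_convexOn_univ {C : ℝ → ℝ} (hC : ConvexOn ℝ Set.univ C) : Continuous C :=
  continuousOn_univ.1 (hC.continuousOn isOpen_univ)

/-- The left side adds slope changes at successive grid nodes; they telescope to the chord of `C` on
the `j`-th cell. -/
lemma interpolation_eq (C : ℝ → ℝ) {h : ℝ} (hh : h ≠ 0) (a x : ℝ) (j : ℕ) :
    C a + (C (a + h) - C a) / h * (x - a) + ∑ k ∈ Finset.range j,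
        ((C (a + (k + 2) * h) - C (a + (k + 1) * h)) / h
          - (C (a + (k + 1) * h) - C (a + k * h)) / h) * (x - (a + (k + 1) * h))
      = C (a + j * h)
        + (C (a + (j + 1) * h) - C (a + j * h)) / h * (x - (a + j * h)) := by
  induction j with
  | zero => simp
  | succ j ih =>
    rw [Finset.sum_range_succ, ← add_assoc, ih]
    push_cast
    rw [show (j : ℝ) + 1 + 1 = j + 2 by ring]
    field_simp
    ring

/-- On a compact interval a convex function is uniformly approximated by sums of an affine function
and of nonnegative multiples of hinges. -/
lemma exists_hinge_approx_of_convexOn {C : ℝ → ℝ} (hC : ConvexOn ℝ Set.univ C) (B : ℝ) {ε : ℝ}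
    (hε : 0 < ε) : ∃ (N : ℕ) (α β : ℝ) (c κ : ℕ → ℝ), (∀ k, 0 ≤ c k) ∧ ∀ x, |x| ≤ B →
      |α + β * x + ∑ k ∈ Finset.range N, c k * max 0 (x - κ k) - C x| ≤ ε := by
  have hcont : Continuous C := continuous_of_convexOn_univ hC
  obtain ⟨δ, hδ, hunif⟩ := Metric.uniformContinuousOn_iff.1
    (isCompact_Icc.uniformContinuousOn_of_continuous
      (hcont.continuousOn (s := Set.Icc (-B) (B + 1)))) ε hε
  -- The mesh is below the modulus `δ`, and at most one so that the node to the right of any `x ≤ B`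
  -- stays in `[-B, B + 1]`.
  set h := min (δ / 2) 1
  have hh : 0 < h := lt_min (by linarith) one_pos
  have hhδ : h < δ := (min_le_left _ _).trans_lt (by linarith)
  have hh1 : h ≤ 1 := min_le_right _ _
  obtain ⟨N, hN⟩ := exists_nat_ge (2 * B / h)
  rw [div_le_iff₀ hh] at hN
  refine ⟨N, C (-B) - (C (-B + h) - C (-B)) / h * -B, (C (-B + h) - C (-B)) / h,
    fun k => (C (-B + (k + 2) * h) - C (-B + (k + 1) * h)) / h
      - (C (-B + (k + 1) * h) - C (-B + k * h)) / h, fun k => -B + (k + 1) * h, fun k => ?_,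
    fun x hx => ?_⟩
  · beta_reduce
    rw [← sub_div]
    refine div_nonneg ?_ hh.le
    have := hC.2 (Set.mem_univ (-B + k * h)) (Set.mem_univ (-B + (k + 2) * h))
      (by norm_num : (0 : ℝ) ≤ 1 / 2) (by norm_num : (0 : ℝ) ≤ 1 / 2) (by norm_num)
    simp only [smul_eq_mul] at this
    rw [show 1 / 2 * (-B + k * h) + 1 / 2 * (-B + (k + 2) * h) = -B + (k + 1) * h by ring] at this
    linarith
  · rw [abs_le] at hx
    have hxB : 0 ≤ (x + B) / h := div_nonneg (by linarith) hh.le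
    set j := ⌊(x + B) / h⌋₊
    have hj1 : (j : ℝ) * h ≤ x + B := (le_div_iff₀ hh).1 (Nat.floor_le hxB)
    have hj2 : x + B < (j + 1) * h := (div_lt_iff₀ hh).1 (Nat.lt_floor_add_one _)
    have hjN : j ≤ N := by
      have : (j : ℝ) * h ≤ N * h := by linarith
      exact_mod_cast le_of_mul_le_mul_right this hh
    -- With `x` in the `j`-th cell, hinge `k` has its kink at node `k + 1`: it is linear at `x` for
    -- `k < j` and zero otherwise.
    have hsum : ∑ k ∈ Finset.range N, ((C (-B + (k + 2) * h) - C (-B + (k + 1) * h)) / h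
        - (C (-B + (k + 1) * h) - C (-B + k * h)) / h) * max 0 (x - (-B + (k + 1) * h))
        = ∑ k ∈ Finset.range j, ((C (-B + (k + 2) * h) - C (-B + (k + 1) * h)) / h
        - (C (-B + (k + 1) * h) - C (-B + k * h)) / h) * (x - (-B + (k + 1) * h)) := by
      rw [← Finset.sum_subset (Finset.range_subset_range.2 hjN)]
      · refine Finset.sum_congr rfl fun k hk => ?_
        have hk' : (k : ℝ) + 1 ≤ j := by exact_mod_cast Finset.mem_range.1 hk
        rw [max_eq_right]
        nlinarith [mul_le_mul_of_nonneg_right hk' hh.le]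
      · intro k _ hk
        have hk' : (j : ℝ) ≤ k := by exact_mod_cast not_lt.1 (fun h' => hk (Finset.mem_range.2 h'))
        rw [max_eq_left, mul_zero]
        nlinarith [mul_le_mul_of_nonneg_right hk' hh.le]
    rw [hsum]
    have hint := interpolation_eq C hh.ne' (-B) x j
    set y := -B + j * h
    have hy' : -B + (j + 1) * h = y + h := by simp only [y]; ring
    rw [hy'] at hint
    set θ := (x - y) / h
    have hθ0 : 0 ≤ θ := div_nonneg (by simp only [y]; linarith) hh.le
    have hθ1 : θ ≤ 1 := (div_le_one hh).2 (by simp only [y]; linarith)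
    have hj0 : 0 ≤ (j : ℝ) * h := by positivity
    have hyx : |C y - C x| < ε := hunif y ⟨by simp only [y]; linarith, by simp only [y]; linarith⟩ x
      ⟨hx.1, by linarith⟩ (by
        rw [Real.dist_eq, abs_lt]
        constructor <;> simp only [y] <;> linarith)
    have hyx' : |C (y + h) - C x| < ε := hunif (y + h)
      ⟨by simp only [y]; linarith, by simp only [y]; linarith⟩ x
      ⟨hx.1, by linarith⟩ (by
        rw [Real.dist_eq, abs_lt]
        constructor <;> simp only [y] <;> linarith)
    -- The interpolation error is a convex combination of the differences between `C x` and the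
    -- values at the two adjacent nodes.
    have hval : C (-B) - (C (-B + h) - C (-B)) / h * -B + (C (-B + h) - C (-B)) / h * x
        + ∑ k ∈ Finset.range j, ((C (-B + (k + 2) * h) - C (-B + (k + 1) * h)) / h
        - (C (-B + (k + 1) * h) - C (-B + k * h)) / h) * (x - (-B + (k + 1) * h)) - C x
        = (1 - θ) * (C y - C x) + θ * (C (y + h) - C x) := by
      have : (C (y + h) - C y) / h * (x - y) = θ * (C (y + h) - C y) := by
        simp only [θ]; ring
      rw [this] at hint
      linarith
    rw [hval]
    rw [abs_lt] at hyx hyx'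
    rw [abs_le]
    constructor <;> nlinarith [mul_le_mul_of_nonneg_left hyx.1.le (sub_nonneg.2 hθ1),
      mul_le_mul_of_nonneg_left hyx.2.le (sub_nonneg.2 hθ1),
      mul_le_mul_of_nonneg_left hyx'.1.le hθ0, mul_le_mul_of_nonneg_left hyx'.2.le hθ0]

variable {Ω Ω' : Type*} [MeasurableSpace Ω] [MeasurableSpace Ω']

lemma integral_affine_add_hinges (P : Measure Ω) [IsProbabilityMeasure P] {X : Ω → ℝ}
    (hX : Measurable X) {B : ℝ} (hB : ∀ x, |X x| ≤ B) (N : ℕ) (α β : ℝ) (c κ : ℕ → ℝ) :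
    Integrable (fun x => α + β * X x + ∑ k ∈ Finset.range N, c k * max 0 (X x - κ k)) P ∧
    ∫ x, (α + β * X x + ∑ k ∈ Finset.range N, c k * max 0 (X x - κ k)) ∂P
      = α + β * ∫ x, X x ∂P + ∑ k ∈ Finset.range N, c k * ∫ x, max 0 (X x - κ k) ∂P := by
  have hmem : ∀ᵐ x ∂P, X x ∈ Set.Icc (-B) B := ae_of_all _ fun x => abs_le.1 (hB x)
  have h1 : Integrable X P := integrable_comp_of_mem_Icc continuous_id hX.aestronglyMeasurable hmem
  have h2 : ∀ k, Integrable (fun x => max 0 (X x - κ k)) P := fun k =>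
    integrable_comp_of_mem_Icc (v := fun y => max 0 (y - κ k)) (by fun_prop)
      hX.aestronglyMeasurable hmem
  have h3 : Integrable (fun x => α + β * X x) P := (integrable_const α).add (h1.const_mul β)
  have h4 : Integrable (fun x => ∑ k ∈ Finset.range N, c k * max 0 (X x - κ k)) P :=
    integrable_finsetSum _ fun k _ => (h2 k).const_mul _
  refine ⟨h3.add h4, ?_⟩
  rw [integral_add h3 h4, integral_add (integrable_const α) (h1.const_mul β),
    integral_finsetSum _ fun k _ => (h2 k).const_mul _]
  simp [integral_const_mul]

/-- For bounded random variables with equal means, the convex order follows from the inequalities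
for hinges. -/
lemma ConvexOrder.of_hinges {P : Measure Ω} {Q : Measure Ω'} [IsProbabilityMeasure P]
    [IsProbabilityMeasure Q] {X : Ω → ℝ} {Y : Ω' → ℝ} (hX : Measurable X) (hY : Measurable Y)
    {B : ℝ} (hXB : ∀ x, |X x| ≤ B) (hYB : ∀ y, |Y y| ≤ B)
    (hmean : ∫ x, X x ∂P = ∫ y, Y y ∂Q)
    (hinge : ∀ κ, ∫ y, max 0 (Y y - κ) ∂Q ≤ ∫ x, max 0 (X x - κ) ∂P) :
    ConvexOrder P X Q Y := by
  intro C hC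
  have hcont : Continuous C := continuous_of_convexOn_univ hC
  refine le_of_forall_pos_le_add fun ε hε => ?_
  obtain ⟨N, α, β, c, κ, hc, happ⟩ := exists_hinge_approx_of_convexOn hC B (half_pos hε)
  obtain ⟨hiX, hX'⟩ := integral_affine_add_hinges P hX hXB N α β c κ
  obtain ⟨hiY, hY'⟩ := integral_affine_add_hinges Q hY hYB N α β c κ
  have hCX : Integrable (fun x => C (X x)) P := integrable_comp_of_mem_Icc hcont
    hX.aestronglyMeasurable (ae_of_all _ fun x => abs_le.1 (hXB x))
  have hCY : Integrable (fun y => C (Y y)) Q := integrable_comp_of_mem_Icc hcont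
    hY.aestronglyMeasurable (ae_of_all _ fun y => abs_le.1 (hYB y))
  have h1 := integral_mono hCY (hiY.add (integrable_const (ε / 2))) fun y => by
    have := (abs_le.1 (happ _ (hYB y))).1
    simp only [Pi.add_apply]
    linarith
  have h2 := integral_mono hiX (hCX.add (integrable_const (ε / 2))) fun x => by
    have := (abs_le.1 (happ _ (hXB x))).2
    simp only [Pi.add_apply]
    linarith
  have h3 : ∑ k ∈ Finset.range N, c k * ∫ y, max 0 (Y y - κ k) ∂Q
      ≤ ∑ k ∈ Finset.range N, c k * ∫ x, max 0 (X x - κ k) ∂P :=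
    Finset.sum_le_sum fun k _ => mul_le_mul_of_nonneg_left (hinge _) (hc k)
  rw [integral_add' hiY (integrable_const _), hY', integral_const, probReal_univ, one_smul] at h1
  rw [integral_add' hCX (integrable_const _), hX', integral_const, probReal_univ, one_smul] at h2
  rw [hmean] at h2
  linarith

variable {n : ℕ}

lemma Experiment.integral_sum_mul_posterior (F : Experiment n) {q : Fin n → ℝ}
    (hq : q ∈ beliefs n) (b : Fin n → ℝ) :
    ∫ x, ∑ i, b i * F.posterior q x i ∂(F.mixLaw q) = ∑ i, b i * q i := by
  rw [F.integral_mixLaw hq]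
  simp_rw [Finset.mul_sum, mul_left_comm _ (b _), F.mixDensity_mul_posterior hq]
  rw [integral_finsetSum _ fun i _ => ((F.integrable_density i.succ).const_mul _).const_mul _]
  simp_rw [integral_const_mul, integral_density, mul_one]

/-- The nonnegative mixture density moves inside the maximum and cancels the denominator of the
posterior; `κ` is spread over all states because posterior probabilities sum to one. -/
lemma Experiment.integral_hinge_posterior (F : Experiment n) {q : Fin n → ℝ}
    (hq : q ∈ beliefs n) (b : Fin n → ℝ) (κ : ℝ) :
    ∫ x, max 0 (∑ i, b i * F.posterior q x i - κ) ∂(F.mixLaw q)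
      = ∫ x, max 0 (∑ i, (Fin.cons 0 b - fun _ => κ : Fin (n + 1) → ℝ) i * stateProb q i *
          F.density i x) ∂(intervalVolume F.lo F.hi) := by
  rw [F.integral_mixLaw hq]
  refine integral_congr_ae (ae_of_all _ fun x => ?_)
  simp only
  rw [mul_max_of_nonneg _ _ (F.mixDensity_nonneg hq x), mul_zero, mul_sub, Finset.mul_sum]
  congr 1
  simp_rw [mul_left_comm _ (b _), F.mixDensity_mul_posterior hq, Pi.sub_apply, sub_mul,
    Finset.sum_sub_distrib, mul_assoc, ← Finset.mul_sum]
  rw [Fin.sum_univ_succ]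
  simp only [Fin.cons_zero, Fin.cons_succ, stateProb_succ, zero_mul, zero_add,
    Experiment.mixDensity]
  ring

lemma lbDominates_of_hinges {F G : Experiment n}
    (h : ∀ l : Fin (n + 1) → ℝ,
      ∫ x, max 0 (∑ i, l i * G.density i x) ∂(intervalVolume G.lo G.hi)
        ≤ ∫ x, max 0 (∑ i, l i * F.density i x) ∂(intervalVolume F.lo F.hi)) :
    F.LBDominates G := by
  intro q hq b
  have := F.isProbabilityMeasure_mixLaw hq
  have := G.isProbabilityMeasure_mixLaw hq
  refine ConvexOrder.of_hinges (F.measurable_sum_mul_posterior q b)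
    (G.measurable_sum_mul_posterior q b) (F.abs_sum_mul_posterior_le hq b)
    (G.abs_sum_mul_posterior_le hq b) ?_ fun κ => ?_
  · rw [F.integral_sum_mul_posterior hq, G.integral_sum_mul_posterior hq]
  · rw [F.integral_hinge_posterior hq, G.integral_hinge_posterior hq]
    exact h _

end Hinges

/-! ### Two-type environments and optimal tests -/

section TwoTypes

open Classical in
/-- The screening environment with one alternative, an ex post signal which is always informative,
two equally likely types `p` and `p'`, and a risk-neutral principal who pays transfers in
`[0, 1]`. -/
def twoTypeEnvironment {n : ℕ} {p p' : Fin n → ℝ} (hp : p ∈ beliefs n) (hp' : p' ∈ beliefs n)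
    (hne : p ≠ p') (u : Fin (n + 1) → ℝ) : ScreeningEnvironment n where
  k := 0
  prior := (1 / 2 : ℝ) • p + (1 / 2 : ℝ) • p'
  prior_mem := convex_beliefs n hp hp' (by norm_num) (by norm_num) (by norm_num)
  types := {p, p'}
  types_subset := by
    intro x hx
    rcases Finset.mem_insert.1 hx with rfl | hx
    · exact hp
    · exact Finset.mem_singleton.1 hx ▸ hp'
  typeProb := fun _ => 1 / 2
  typeProb_mem := by
    refine ⟨fun _ => by norm_num, ?_⟩
    rw [Finset.sum_const, Finset.card_univ, Fintype.card_coe, Finset.card_pair hne]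
    norm_num
  mean_type := by
    rw [Finset.sum_coe_sort {p, p'} fun x : Fin n → ℝ => (1 / 2 : ℝ) • x, Finset.sum_pair hne]
  psi := fun _ => 1
  psi_mem := fun _ => ⟨zero_le_one, le_rfl⟩
  v₁ := fun _ _ => 0
  v₂ := id
  continuous_v₂ := continuous_id
  convexOn_v₂ := convexOn_id convex_univ
  u₁ := fun _ => u
  mLo := 0
  mHi := 1
  mLo_lt_mHi := zero_lt_one

namespace twoTypeEnvironment

variable {n : ℕ} {p p' : Fin n → ℝ} (hp : p ∈ beliefs n) (hp' : p' ∈ beliefs n) (hne : p ≠ p')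
  (u : Fin (n + 1) → ℝ)

/-- The type `p`. -/
def fstType : (twoTypeEnvironment hp hp' hne u).types :=
  ⟨p, by classical exact Finset.mem_insert_self _ _⟩

/-- The type `p'`. -/
def sndType : (twoTypeEnvironment hp hp' hne u).types :=
  ⟨p', by classical exact Finset.mem_insert_of_mem (Finset.mem_singleton_self _)⟩

lemma sum_types (g : (twoTypeEnvironment hp hp' hne u).types → ℝ) :
    ∑ x, g x = g (fstType hp hp' hne u) + g (sndType hp hp' hne u) := by
  classical
  have hne' : fstType hp hp' hne u ≠ sndType hp hp' hne u := fun h => hne (congrArg Subtype.val h)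
  rw [← Finset.sum_pair hne']
  refine (Finset.sum_subset (Finset.subset_univ _) fun x _ hx => absurd ?_ hx).symm
  obtain ⟨x, hx'⟩ := x
  rcases Finset.mem_insert.1 hx' with rfl | hx'
  · exact Finset.mem_insert_self _ _
  · obtain rfl := Finset.mem_singleton.1 hx'
    exact Finset.mem_insert_of_mem (Finset.mem_singleton_self _)

variable {hp hp' hne u} {F : Experiment n}

lemma alloc_zero (M : (twoTypeEnvironment hp hp' hne u).Mechanism F)
    (x : (twoTypeEnvironment hp hp' hne u).types) : M.alloc x (0 : Fin 1) = 1 := by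
  have h := (M.alloc_mem x).2
  exact (Fin.sum_univ_one (M.alloc x)).symm.trans h

lemma integral_transfer (M : (twoTypeEnvironment hp hp' hne u).Mechanism F)
    (x : (twoTypeEnvironment hp hp' hne u).types) (i : Fin (n + 1)) :
    ∫ s, M.transfer x (0 : Fin 1) s ∂((twoTypeEnvironment hp hp' hne u).exPostLaw F (0 : Fin 1) i)
      = ∫ s, M.transfer x (0 : Fin 1) (Sum.inl s) ∂(F.law i) := by
  refine (M.integral_transfer x (0 : Fin 1) i).trans ?_
  change 1 * _ + (1 - 1) * _ = _
  ring

lemma agentUtility_eq (M : (twoTypeEnvironment hp hp' hne u).Mechanism F)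
    (x y : (twoTypeEnvironment hp hp' hne u).types) :
    M.agentUtility x y = (∑ i, stateProb (x : Fin n → ℝ) i * u i) + ∑ i,
      stateProb (x : Fin n → ℝ) i * ∫ s, M.transfer y (0 : Fin 1) (Sum.inl s) ∂(F.law i) := by
  refine (Fin.sum_univ_one _).trans ?_
  rw [alloc_zero, one_mul, ← Finset.sum_add_distrib]
  refine Finset.sum_congr rfl fun i _ => ?_
  rw [integral_transfer, mul_add]
  rfl

lemma principalUtility_eq (M : (twoTypeEnvironment hp hp' hne u).Mechanism F) :
    M.principalUtility
      = -(1 / 2) * ((∑ i, stateProb p i *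
          ∫ s, M.transfer (fstType hp hp' hne u) (0 : Fin 1) (Sum.inl s) ∂(F.law i))
        + ∑ i, stateProb p' i *
          ∫ s, M.transfer (sndType hp hp' hne u) (0 : Fin 1) (Sum.inl s) ∂(F.law i)) := by
  have h : ∀ x : (twoTypeEnvironment hp hp' hne u).types,
      ∑ a, M.alloc x a * ∑ i, stateProb (x : Fin n → ℝ) i *
        ((twoTypeEnvironment hp hp' hne u).v₁ a i - ∫ s, (twoTypeEnvironment hp hp' hne u).v₂
          (M.transfer x a s) ∂((twoTypeEnvironment hp hp' hne u).exPostLaw F a i))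
      = -∑ i, stateProb (x : Fin n → ℝ) i *
          ∫ s, M.transfer x (0 : Fin 1) (Sum.inl s) ∂(F.law i) := by
    intro x
    refine (Fin.sum_univ_one _).trans ?_
    rw [alloc_zero, one_mul, ← Finset.sum_neg_distrib]
    refine Finset.sum_congr rfl fun i _ => ?_
    rw [← integral_transfer, ← mul_neg, ← zero_sub]
    rfl
  rw [ScreeningEnvironment.Mechanism.principalUtility, sum_types, h, h]
  change 1 / 2 * -(∑ i, stateProb p i * _) + 1 / 2 * -(∑ i, stateProb p' i * _) = _
  ring

/-- The mechanism with the same transfer rule for both types. -/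
def pooling {t : F.Signal → ℝ} (ht : Measurable t) (htm : ∀ x, t x ∈ Set.Icc (0 : ℝ) 1) :
    (twoTypeEnvironment hp hp' hne u).Mechanism F where
  alloc := fun _ _ => 1
  alloc_mem := fun _ => ⟨fun _ => zero_le_one, Fin.sum_univ_one _⟩
  transfer := fun _ _ => Sum.elim t fun _ => 0
  measurable_transfer := fun _ _ => Measurable.sumElim ht measurable_const
  transfer_mem := fun _ _ s => by
    cases s with
    | inl x => exact htm x
    | inr _ => exact ⟨le_rfl, zero_le_one⟩

end twoTypeEnvironment

open twoTypeEnvironment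

variable {n : ℕ}

lemma Experiment.integrable_sum_mul_density (F : Experiment n) (l : Fin (n + 1) → ℝ) :
    Integrable (fun x => ∑ i, l i * F.density i x) (intervalVolume F.lo F.hi) :=
  integrable_finsetSum _ fun i _ => (F.integrable_density i).const_mul _

lemma Experiment.integrable_hinge (F : Experiment n) (l : Fin (n + 1) → ℝ) :
    Integrable (fun x => max 0 (∑ i, l i * F.density i x)) (intervalVolume F.lo F.hi) :=
  (integrable_zero _ _ _).sup (F.integrable_sum_mul_density l)

lemma Experiment.sum_mul_integral_law_le_hinge (F : Experiment n) (l : Fin (n + 1) → ℝ)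
    {t : F.Signal → ℝ} (ht : Measurable t) (htm : ∀ x, t x ∈ Set.Icc (0 : ℝ) 1) :
    ∑ i, l i * ∫ x, t x ∂(F.law i)
      ≤ ∫ x, max 0 (∑ i, l i * F.density i x) ∂(intervalVolume F.lo F.hi) := by
  have htb : ∀ x, |t x| ≤ 1 := fun x => abs_le.2 ⟨by linarith [(htm x).1], (htm x).2⟩
  rw [F.sum_mul_integral_law l ht htb]
  refine integral_mono ((F.integrable_sum_mul_density l).mul_bdd (c := 1) ht.aestronglyMeasurable
    (ae_of_all _ htb)) (F.integrable_hinge l) fun x => ?_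
  exact (mul_le_mul_of_nonneg_right (le_max_right 0 _) (htm x).1).trans
    (mul_le_of_le_one_right (le_max_left _ _) (htm x).2)

/-- As in the Neyman–Pearson lemma, the bound of `sum_mul_integral_law_le_hinge` is attained by
paying one exactly where the combined density is positive. -/
lemma Experiment.exists_test (G : Experiment n) (l : Fin (n + 1) → ℝ) :
    ∃ t : G.Signal → ℝ, Measurable t ∧ (∀ x, t x ∈ Set.Icc (0 : ℝ) 1) ∧
      ∑ i, l i * ∫ x, t x ∂(G.law i)
        = ∫ x, max 0 (∑ i, l i * G.density i x) ∂(intervalVolume G.lo G.hi) := by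
  have hm : Measurable fun x => ∑ i, l i * G.density i x :=
    Finset.measurable_sum _ fun i _ => (G.measurable_density i).const_mul _
  set t : G.Signal → ℝ := {x | 0 < ∑ i, l i * G.density i x}.indicator fun _ => 1
  have ht : Measurable t := measurable_const.indicator (measurableSet_lt measurable_const hm)
  have htm : ∀ x, t x ∈ Set.Icc (0 : ℝ) 1 := fun x =>
    ⟨Set.indicator_nonneg (fun _ _ => zero_le_one) x,
      Set.indicator_le' (fun _ _ => le_rfl) (fun _ _ => zero_le_one) x⟩
  refine ⟨t, ht, htm, ?_⟩
  rw [G.sum_mul_integral_law l ht (B := 1)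
    fun x => abs_le.2 ⟨by linarith [(htm x).1], (htm x).2⟩]
  refine integral_congr_ae (ae_of_all _ fun x => ?_)
  simp only [t]
  by_cases hx : 0 < ∑ i, l i * G.density i x
  · rw [Set.indicator_of_mem (by exact hx), mul_one, max_eq_right hx.le]
  · rw [Set.indicator_of_notMem (by exact hx), mul_zero, max_eq_left (not_lt.1 hx)]

/-- The hinge inequality for the difference of multiples of two beliefs with disjoint supports. -/
lemma hinge_le_of_optimalValue_le {F G : Experiment n}
    (h : ∀ E : ScreeningEnvironment n, E.optimalValue G ≤ E.optimalValue F)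
    {p p' : Fin n → ℝ} (hp : p ∈ beliefs n) (hp' : p' ∈ beliefs n) (S : Set (Fin (n + 1)))
    (hpS : ∀ i ∉ S, stateProb p i = 0) (hpS' : ∀ i ∈ S, stateProb p' i = 0) {α β : ℝ}
    (hα : 0 ≤ α) (hβ : 0 ≤ β) :
    ∫ x, max 0 (∑ i, (α * stateProb p i - β * stateProb p' i) * G.density i x)
        ∂(intervalVolume G.lo G.hi)
      ≤ ∫ x, max 0 (∑ i, (α * stateProb p i - β * stateProb p' i) * F.density i x)
        ∂(intervalVolume F.lo F.hi) := by
  classical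
  have hne : p ≠ p' := by
    rintro rfl
    have : ∀ i, stateProb p i = 0 := fun i => by
      by_cases hi : i ∈ S
      · exact hpS' i hi
      · exact hpS i hi
    have h1 := sum_stateProb p
    simp [this] at h1
  obtain ⟨t, ht, htm, htG⟩ := G.exists_test fun i => α * stateProb p i - β * stateProb p' i
  have hsplit : ∀ c : Fin (n + 1) → ℝ, ∑ i, (α * stateProb p i - β * stateProb p' i) * c i
      = α * ∑ i, stateProb p i * c i - β * ∑ i, stateProb p' i * c i := fun c => by
    rw [Finset.mul_sum, Finset.mul_sum, ← Finset.sum_sub_distrib]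
    exact Finset.sum_congr rfl fun i _ => by ring
  rw [← htG, hsplit]
  set r := ∑ i, stateProb p i * ∫ x, t x ∂(G.law i)
  set ρ := ∑ i, stateProb p' i * ∫ x, t x ∂(G.law i)
  have hρ : 0 ≤ ρ := Finset.sum_nonneg fun i _ =>
    mul_nonneg (stateProb_nonneg hp' i) (integral_nonneg fun x => (htm x).1)
  -- Disjoint supports allow a utility with mean `-r` for `p` and `0` for `p'`: under the pooling
  -- test on `G` the participation constraint of `p` binds, and that of `p'` holds because transfers
  -- are nonnegative.
  set u : Fin (n + 1) → ℝ := fun i => if i ∈ S then -r else 0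
  have hu : ∑ i, stateProb p i * u i = -r := by
    rw [← one_mul (-r), ← sum_stateProb p, Finset.sum_mul]
    refine Finset.sum_congr rfl fun i _ => ?_
    by_cases hi : i ∈ S
    · simp [u, hi]
    · simp [u, hi, hpS i hi]
  have hu' : ∑ i, stateProb p' i * u i = 0 := Finset.sum_eq_zero fun i _ => by
    by_cases hi : i ∈ S
    · simp [hpS' i hi]
    · simp [u, hi]
  set E := twoTypeEnvironment hp hp' hne u
  set x₁ : E.types := fstType hp hp' hne u
  set x₂ : E.types := sndType hp hp' hne u
  set M : E.Mechanism G := pooling ht htm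
  have hM : M.Feasible := by
    refine ⟨fun x => ?_, fun x y => ?_⟩
    · rw [agentUtility_eq]
      obtain ⟨x, hx⟩ := x
      rcases Finset.mem_insert.1 hx with rfl | hx
      · rw [hu]
        exact le_of_eq (neg_add_cancel r).symm
      · obtain rfl := Finset.mem_singleton.1 hx
        rw [hu', zero_add]
        exact hρ
    · rw [agentUtility_eq, agentUtility_eq]
      exact le_rfl
  have hMval : M.principalUtility = -(1 / 2) * (r + ρ) := principalUtility_eq M
  refine le_of_forall_pos_le_add fun ε hε => ?_
  -- The supremum under `F` need not be attained, so a `δ`-optimal mechanism is used; `β + 1` keeps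
  -- the denominator positive when `β = 0`.
  set δ := ε / (2 * (β + 1))
  have hδ : 0 < δ := by positivity
  have hlt : ((M.principalUtility - δ : ℝ) : EReal) < E.optimalValue F := by
    refine lt_of_lt_of_le (EReal.coe_lt_coe_iff.2 (sub_lt_self _ hδ)) (le_trans ?_ (h E))
    exact le_iSup₂ (f := fun (M : E.Mechanism G) (_ : M.Feasible) => (M.principalUtility : EReal))
      M hM
  obtain ⟨M', hlt⟩ := lt_iSup_iff.1 hlt
  obtain ⟨hM', hlt⟩ := lt_iSup_iff.1 hlt
  rw [EReal.coe_lt_coe_iff, hMval, principalUtility_eq] at hlt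
  have hIR := hM'.1 x₁
  have hIC := hM'.2 x₂ x₁
  rw [agentUtility_eq] at hIR
  rw [agentUtility_eq, agentUtility_eq] at hIC
  change 0 ≤ (∑ i, stateProb p i * u i) + ∑ i, stateProb p i * _ at hIR
  rw [hu] at hIR
  have hIC' := le_of_add_le_add_left hIC
  change ∑ i, stateProb p' i * _ ≤ ∑ i, stateProb p' i * _ at hIC'
  have hF := F.sum_mul_integral_law_le_hinge (fun i => α * stateProb p i - β * stateProb p' i)
    ((M'.measurable_transfer x₁ (0 : Fin 1)).comp measurable_inl)
    (fun x => M'.transfer_mem x₁ (0 : Fin 1) (Sum.inl x))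
  refine le_trans ?_ (add_le_add_left hF ε)
  rw [hsplit]
  simp only [Function.comp_apply]
  set a := ∑ i, stateProb p i * ∫ s, M'.transfer x₁ (0 : Fin 1) (Sum.inl s) ∂(F.law i)
  set b := ∑ i, stateProb p' i * ∫ s, M'.transfer x₁ (0 : Fin 1) (Sum.inl s) ∂(F.law i)
  -- Participation of `p` gives `r ≤ a`. By incentive compatibility `p'` receives at least `b`,
  -- while near-optimality caps the sum of the two types' expected transfers by `r + ρ + 2 * δ`;
  -- hence `b ≤ ρ + 2 * δ`. The transfer meant for `p` is thus nearly as good a test as `t`.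
  have hra : r ≤ a := by linarith
  have hb : b ≤ ρ + 2 * δ := by linarith
  have h1 := mul_le_mul_of_nonneg_left hra hα
  have h2 := mul_le_mul_of_nonneg_left hb hβ
  have h3 : β * (2 * δ) ≤ ε := by
    have : ε = 2 * (β + 1) * δ := (mul_div_cancel₀ _ (by positivity)).symm
    rw [this]
    nlinarith
  linarith

/-- The positive and negative parts of `l`, normalized, are beliefs with disjoint supports. If one
part vanishes it cannot be normalized, but then either the left side is zero or both sides equal `∑
i, l i`. -/
lemma hinge_le {F G : Experiment n}
    (h : ∀ E : ScreeningEnvironment n, E.optimalValue G ≤ E.optimalValue F)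
    (l : Fin (n + 1) → ℝ) :
    ∫ x, max 0 (∑ i, l i * G.density i x) ∂(intervalVolume G.lo G.hi)
      ≤ ∫ x, max 0 (∑ i, l i * F.density i x) ∂(intervalVolume F.lo F.hi) := by
  have hα0 : ∀ i, 0 ≤ max (l i) 0 := fun i => le_max_right _ _
  have hβ0 : ∀ i, 0 ≤ max (-l i) 0 := fun i => le_max_right _ _
  rcases (Finset.sum_nonneg fun i _ => hα0 i).eq_or_lt with hα | hα
  · have hl : ∀ i, l i ≤ 0 := fun i => by
      have := (Finset.sum_eq_zero_iff_of_nonneg fun i _ => hα0 i).1 hα.symm i (Finset.mem_univ i)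
      exact max_eq_right_iff.1 this
    have : ∀ x, max 0 (∑ i, l i * G.density i x) = 0 := fun x => max_eq_left
      (Finset.sum_nonpos fun i _ => mul_nonpos_of_nonpos_of_nonneg (hl i) (G.density_nonneg i x))
    simp_rw [this, integral_zero]
    exact integral_nonneg fun x => le_max_left _ _
  rcases (Finset.sum_nonneg fun i _ => hβ0 i).eq_or_lt with hβ | hβ
  · have hl : ∀ i, 0 ≤ l i := fun i => by
      have := (Finset.sum_eq_zero_iff_of_nonneg fun i _ => hβ0 i).1 hβ.symm i (Finset.mem_univ i)
      exact neg_nonpos.1 (max_eq_right_iff.1 this)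
    have heq : ∀ H : Experiment n,
        ∫ x, max 0 (∑ i, l i * H.density i x) ∂(intervalVolume H.lo H.hi) = ∑ i, l i := fun H => by
      have : ∀ x, max 0 (∑ i, l i * H.density i x) = ∑ i, l i * H.density i x := fun x =>
        max_eq_right (Finset.sum_nonneg fun i _ => mul_nonneg (hl i) (H.density_nonneg i x))
      simp_rw [this]
      rw [integral_finsetSum _ fun i _ => (H.integrable_density i).const_mul _]
      simp_rw [integral_const_mul, H.integral_density, mul_one]
    rw [heq, heq]
  set α := ∑ i, max (l i) 0
  set β := ∑ i, max (-l i) 0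
  have hP1 : ∑ i, max (l i) 0 / α = 1 := by rw [← Finset.sum_div, div_self hα.ne']
  have hR1 : ∑ i, max (-l i) 0 / β = 1 := by rw [← Finset.sum_div, div_self hβ.ne']
  have key := hinge_le_of_optimalValue_le h
    (comp_succ_mem_beliefs (fun i => div_nonneg (hα0 i) hα.le) hP1)
    (comp_succ_mem_beliefs (fun i => div_nonneg (hβ0 i) hβ.le) hR1) {i | 0 < l i}
    (fun i hi => by
      rw [stateProb_comp_succ hP1]
      beta_reduce
      rw [max_eq_right (not_lt.1 hi), zero_div])
    (fun i hi => by
      have hi' : 0 < l i := hi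
      rw [stateProb_comp_succ hR1]
      beta_reduce
      rw [max_eq_right (by linarith), zero_div]) hα.le hβ.le
  rw [stateProb_comp_succ hP1, stateProb_comp_succ hR1] at key
  have hl : ∀ i, α * (max (l i) 0 / α) - β * (max (-l i) 0 / β) = l i := fun i => by
    rw [mul_div_cancel₀ _ hα.ne', mul_div_cancel₀ _ hβ.ne']
    rcases le_total (l i) 0 with hi | hi
    · rw [max_eq_right hi, max_eq_left (by linarith)]
      ring
    · rw [max_eq_left hi, max_eq_right (by linarith)]
      ring
  simpa only [hl] using key

end TwoTypes

end LinearBlackwell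

end

theorem theorem3 (n : ℕ) (F G : LinearBlackwell.Experiment n) :
    F.LBDominates G ↔
      ∀ E : LinearBlackwell.ScreeningEnvironment n, E.optimalValue G ≤ E.optimalValue F :=
  ⟨fun h E => E.optimalValue_le_of_lbDominates h,
    fun h => LinearBlackwell.lbDominates_of_hinges (LinearBlackwell.hinge_le h)⟩
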